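/- Let $d\ge 1$, $1\le p<\infty$, and let $\Omega\subset\mathbb{R}^d$ be open, bounded, connected and polyhedral (its boundary is a finite union of parts of hyperplanes). A discretisation $\mathcal D=(\mathcal M,\mathcal E,\mathcal P)$ of $\Omega$ consists of the following. (1) $\mathcal M$ is a finite family of nonempty connected open disjoint subsets of $\Omega$ (the control volumes) with $\overline\Omega=\bigcup_{K\in\mathcal M}\overline K$. (2) $\mathcal E$ is a finite family of disjoint subsets of $\overline\Omega$ (the edges). Each $\sigma\in\mathcal E$ is a nonempty open subset of a hyperplane, its $(d-1)$-dimensional Lebesgue measure $|\sigma|$ is positive, and $\overline\sigma\setminus\sigma$ has $(d-1)$-dimensional measure zero. Each $K\in\mathcal M$ comes with a subset $\mathcal E_K\subset\mathcal E$ such that $\partial K=\bigcup_{\sigma\in\mathcal E_K}\overline\sigma$. With $\mathcal M_\sigma=\{K\in\mathcal M:\sigma\in\mathcal E_K\}$, for every $\sigma\in\mathcal E$ either $\mathcal M_\sigma$ has exactly one element and $\sigma\subset\partial\Omega$, or $\mathcal M_\sigma$ has exactly two elements. (3) $\mathcal P=(x_K)_{K\in\mathcal M}$ is a family of points with $x_K\in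 K$, such that $K$ is star-shaped with respect to $x_K$ and, for every $\sigma\in\mathcal E_K$, the Euclidean distance $d_{K,\sigma}$ from $x_K$ to the hyperplane including $\sigma$ is positive. Let $H_{\mathcal D}(\Omega)$ be the set of functions $u$ on $\Omega$ that are constant on each $K\in\mathcal M$, with value $u_K$ (functions being identified when they agree almost everywhere). If $\mathcal M_\sigma=\{K,L\}$ with $K\neq L$, put $D_\sigma u=|u_K-u_L|$ and $d_\sigma=d_{K,\sigma}+d_{L,\sigma}$; if $\mathcal M_\sigma=\{K\}$, put $D_\sigma u=|u_K|$ and $d_\sigma=d_{K,\sigma}$. Define $$\|u\|_{1,p,\mathcal M}=\Big(\sum_{K\in\mathcal M}\sum_{\sigma\in\mathcal E_K}|\sigma|\,d_{K,\sigma}\Big(\frac{D_\sigma u}{d_\sigma}\Big)^p\Big)^{1/p}.$$ Let $F$ be a family of discretisations of $\Omega$, and let $\eta>0$ be such that, for all $\mathcal D\in F$, $\eta\le d_{K,\sigma}/d_{L,\sigma}\le 1/\eta$ for every edge $\sigma$ of $\mathcal D$ with $\mathcal M_\sigma=\{K,L\}$, $K\ne L$. For each $\mathcal D\in F$ let $u_{\mathcal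 D}\in H_{\mathcal D}(\Omega)$, and assume that there is $C\in\mathbb{R}$ with $\|u_{\mathcal D}\|_{1,p,\mathcal M}\le C$ for all $\mathcal D\in F$. Then the family $(u_{\mathcal D})_{\mathcal D\in F}$ is relatively compact in $L^p(\Omega)$, and also in $L^p(\mathbb{R}^d)$ when each $u_{\mathcal D}$ is extended by $0$ outside $\Omega$. -/

import Mathlib

open MeasureTheory
open scoped ENNReal

/-- A subset of `ℝ^d` is polyhedral when its boundary is a finite union of parts of hyperplanes,
i.e. when its boundary is contained in the union of finitely many hyperplanes. -/
def IsPolyhedral {d : ℕ} (Ω : Set (EuclideanSpace ℝ (Fin d))) : Prop :=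
  ∃ A : Finset (AffineSubspace ℝ (EuclideanSpace ℝ (Fin d))),
    (∀ H ∈ A, Module.finrank ℝ H.direction + 1 = d) ∧
      frontier Ω ⊆ ⋃ H ∈ A, (H : Set (EuclideanSpace ℝ (Fin d)))

/-- The `(d-1)`-dimensional Lebesgue measure of a subset of a hyperplane of `ℝ^d`
(the `(d-1)`-dimensional Hausdorff measure, normalised so as to agree with Lebesgue measure
on `(d-1)`-dimensional Euclidean spaces). -/
noncomputable def surfaceMeasure (d : ℕ) : Measure (EuclideanSpace ℝ (Fin d)) :=
  Measure.euclideanHausdorffMeasure (d - 1)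

/-- A space discretisation `(M, E, P)` of an open set `Ω` of `ℝ^d`: `cells` is the family `M` of
control volumes, `edges` is the family `E` of edges, `edgesOf K` is the subset `E_K` of `E` that is
attached to the control volume `K`, and `point K` is the point `x_K`.
(The values of `edgesOf` and `point` outside `cells` are irrelevant.) -/
structure SpaceDiscretisation {d : ℕ} (Ω : Set (EuclideanSpace ℝ (Fin d))) where
  cells : Finset (Set (EuclideanSpace ℝ (Fin d)))
  edges : Finset (Set (EuclideanSpace ℝ (Fin d)))
  edgesOf : Set (EuclideanSpace ℝ (Fin d)) → Finset (Set (EuclideanSpace ℝ (Fin d)))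
  point : Set (EuclideanSpace ℝ (Fin d)) → EuclideanSpace ℝ (Fin d)
  cell_subset : ∀ K ∈ cells, K ⊆ Ω
  cell_isOpen : ∀ K ∈ cells, IsOpen K
  cell_isConnected : ∀ K ∈ cells, IsConnected K
  cell_disjoint : ∀ K ∈ cells, ∀ L ∈ cells, K ≠ L → Disjoint K L
  closure_eq : closure Ω = ⋃ K ∈ cells, closure K
  edge_subset : ∀ σ ∈ edges, σ ⊆ closure Ω
  edge_nonempty : ∀ σ ∈ edges, σ.Nonempty
  edge_disjoint : ∀ σ ∈ edges, ∀ τ ∈ edges, σ ≠ τ → Disjoint σ τ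
  /-- Each edge is an open subset of a hyperplane. -/
  edge_open_in_hyperplane : ∀ σ ∈ edges,
    ∃ H : AffineSubspace ℝ (EuclideanSpace ℝ (Fin d)),
      Module.finrank ℝ H.direction + 1 = d ∧
        ∃ U : Set (EuclideanSpace ℝ (Fin d)), IsOpen U ∧ σ = U ∩ H
  edge_measure_pos : ∀ σ ∈ edges, 0 < surfaceMeasure d σ
  /-- The boundary of an edge relative to its hyperplane is negligible. -/
  edge_boundary_null : ∀ σ ∈ edges, surfaceMeasure d (closure σ \ σ) = 0
  edgesOf_subset : ∀ K ∈ cells, edgesOf K ⊆ edges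
  cell_boundary : ∀ K ∈ cells, frontier K = ⋃ σ ∈ edgesOf K, closure σ
  /-- An edge belongs either to exactly one control volume, and then lies on the boundary of `Ω`,
  or to exactly two control volumes. -/
  edge_cells : ∀ σ ∈ edges,
    ({K | K ∈ cells ∧ σ ∈ edgesOf K}.ncard = 1 ∧ σ ⊆ frontier Ω) ∨
      {K | K ∈ cells ∧ σ ∈ edgesOf K}.ncard = 2
  point_mem : ∀ K ∈ cells, point K ∈ K
  cell_starConvex : ∀ K ∈ cells, StarConvex ℝ (point K) K
  /-- The distance `d_{K,σ}` of `x_K` to the hyperplane that includes `σ` is positive; as `σ` is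
  nonempty and open in its hyperplane, this hyperplane is the affine span of `σ`. -/
  dist_pos : ∀ K ∈ cells, ∀ σ ∈ edgesOf K,
    0 < Metric.infDist (point K) (affineSpan ℝ σ : Set (EuclideanSpace ℝ (Fin d)))

namespace SpaceDiscretisation

variable {d : ℕ} {Ω : Set (EuclideanSpace ℝ (Fin d))} (D : SpaceDiscretisation Ω)

open Classical in
/-- The set `M_σ` of the control volumes that have `σ` among their edges. -/
noncomputable def cellsOf (σ : Set (EuclideanSpace ℝ (Fin d))) :
    Finset (Set (EuclideanSpace ℝ (Fin d))) :=
  D.cells.filter fun K => σ ∈ D.edgesOf K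

/-- `d_{K,σ}`: the Euclidean distance between `x_K` and the hyperplane including `σ`. -/
noncomputable def dist (K σ : Set (EuclideanSpace ℝ (Fin d))) : ℝ :=
  Metric.infDist (D.point K) (affineSpan ℝ σ : Set (EuclideanSpace ℝ (Fin d)))

/-- `d_σ`, which is `d_{K,σ} + d_{L,σ}` if `M_σ = {K, L}` and `d_{K,σ}` if `M_σ = {K}`. -/
noncomputable def edgeDist (σ : Set (EuclideanSpace ℝ (Fin d))) : ℝ :=
  ∑ K ∈ D.cellsOf σ, D.dist K σ

/-- `H_M(Ω)`: the functions that are constant on each control volume (only the values on `Ω` of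
such a function are used; `Ω` is the union of the control volumes up to a negligible set). -/
def PiecewiseConstant (u : EuclideanSpace ℝ (Fin d) → ℝ) : Prop :=
  ∀ K ∈ D.cells, ∃ c : ℝ, ∀ x ∈ K, u x = c

/-- The value `u_K` on the control volume `K` of a piecewise constant function `u`. -/
def cellValue (u : EuclideanSpace ℝ (Fin d) → ℝ) (K : Set (EuclideanSpace ℝ (Fin d))) : ℝ :=
  u (D.point K)

open Classical in
/-- `D_σ u`, for an edge `σ` of the control volume `K`: it is `|u_K - u_L|` if `M_σ = {K, L}` and
`|u_K|` if `M_σ = {K}` (see `jump_interior` and `jump_boundary`). -/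
noncomputable def jump (u : EuclideanSpace ℝ (Fin d) → ℝ)
    (K σ : Set (EuclideanSpace ℝ (Fin d))) : ℝ :=
  |D.cellValue u K - ∑ L ∈ (D.cellsOf σ).erase K, D.cellValue u L|

/-- The discrete `W^{1,p}` norm
`(∑_{K ∈ M} ∑_{σ ∈ E_K} |σ| d_{K,σ} (D_σ u / d_σ) ^ p) ^ (1 / p)`. -/
noncomputable def discreteNorm (p : ℝ) (u : EuclideanSpace ℝ (Fin d) → ℝ) : ℝ :=
  (∑ K ∈ D.cells, ∑ σ ∈ D.edgesOf K,
    (surfaceMeasure d).real σ * D.dist K σ * (D.jump u K σ / D.edgeDist σ) ^ p) ^ (1 / p)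

/-- `η ≤ d_{K,σ} / d_{L,σ} ≤ 1 / η` for every edge `σ` with `M_σ = {K, L}`. -/
def RatioBound (η : ℝ) : Prop :=
  ∀ σ ∈ D.edges, ∀ K ∈ D.cellsOf σ, ∀ L ∈ D.cellsOf σ, K ≠ L →
    η ≤ D.dist K σ / D.dist L σ ∧ D.dist K σ / D.dist L σ ≤ 1 / η

open Classical in
theorem jump_interior (u : EuclideanSpace ℝ (Fin d) → ℝ)
    {K L σ : Set (EuclideanSpace ℝ (Fin d))} (hKL : K ≠ L) (h : D.cellsOf σ = {K, L}) :
    D.jump u K σ = |D.cellValue u K - D.cellValue u L| := by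
  have : ({K, L} : Finset (Set (EuclideanSpace ℝ (Fin d)))).erase K = {L} := by
    ext x
    simp only [Finset.mem_erase, Finset.mem_insert, Finset.mem_singleton]
    grind
  rw [jump, h, this, Finset.sum_singleton]

theorem jump_boundary (u : EuclideanSpace ℝ (Fin d) → ℝ)
    {K σ : Set (EuclideanSpace ℝ (Fin d))} (h : D.cellsOf σ = {K}) :
    D.jump u K σ = |D.cellValue u K| := by
  simp [jump, h]

end SpaceDiscretisation

/-! The compactness is obtained in `L¹`, for `φ(u) = u |u|^(p-1)` (`signedPow`) extended by zero.
Since `|a - b|^p ≤ 2^p |φ(a) - φ(b)|`, a finite `L¹` net for the functions `φ(u)` is a finite `L^p`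
net for the functions `u`.

A piecewise constant function changes only across edges. For almost every `x` the segment from `x`
to `x + h` crosses each edge at most once and avoids the relative boundaries of the edges. The
points whose segment meets `σ` have volume at most `‖h‖ |σ|`. Hence the `L¹` norm of the increment
by `h` is at most `‖h‖ ∑ |σ| J σ`, where `J σ` bounds the jump across `σ`
(`BoundsJumps.lintegral_stepFun_translate_le`).

For `φ(u)` the jump is at most `p ∑_K |u_K|^(p-1) D_σ u`, the sum being over the cells of `σ`.
Young's inequality with a parameter `ε`, the ratio bound `d_σ ≤ (1 + 1/η) d_{K,σ}` and the cone
estimate `∑_σ |σ| d_{K,σ} ≤ 2^d |K|` bound the total variation by a constant times `ε 2^d ‖u‖_p^p +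
ε^(1-p) |C|^p` (`sum_powJump_le`).

A translation that moves `Ω` off itself gives a Poincaré inequality: the `L¹` norm of `φ(u)`, which
is `‖u‖_p^p`, is at most the diameter of an enclosing ball times the total variation. For small `ε`
the term in `‖u‖_p^p` is absorbed, so that both quantities are bounded uniformly
(`exists_uniform_bounds`). Kolmogorov's criterion (`exists_finite_net_of_translate_le`) then yields
the nets. -/

open scoped RealInnerProductSpace Pointwise

/-! ### Slicing by parallel hyperplanes, and surface measure -/

theorem volume_eq_lintegral_surfaceMeasure {d : ℕ} {n : EuclideanSpace ℝ (Fin d)} (hn : ‖n‖ = 1)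
    {A : Set (EuclideanSpace ℝ (Fin d))} (hA : MeasurableSet A) :
    volume A = ∫⁻ s : ℝ, surfaceMeasure d (A ∩ {x | ⟪n, x⟫ = s}) := by
  have hn0 : n ≠ 0 := by
    rintro rfl
    simp at hn
  have h := EuclideanGeometry.euclideanHausdorffMeasure_eq_lintegral
    (0 : EuclideanSpace ℝ (Fin d)) hn0 hA
  rw [finrank_euclideanSpace_fin, EuclideanSpace.euclideanHausdorffMeasure_eq_volume] at h
  rw [h, ← ofReal_norm, hn, ENNReal.ofReal_one, one_mul]
  refine lintegral_congr fun s => ?_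
  rw [surfaceMeasure]
  congr 2
  ext x
  simp [AffineSubspace.mem_mk', Submodule.mem_orthogonal_singleton_iff_inner_right, inner_sub_right,
    inner_smul_right, hn, sub_eq_zero]

/-- The slice at each height in `I` is a translate of `S` along `h`, so it has the surface measure
of `S` whatever the inclination of `h`. -/
theorem volume_obliqueCylinder {d : ℕ} {n h : EuclideanSpace ℝ (Fin d)} (hn : ‖n‖ = 1)
    (hh : ⟪n, h⟫ ≠ 0) {a : ℝ} {S : Set (EuclideanSpace ℝ (Fin d))} (hS : MeasurableSet S)
    (hSa : S ⊆ {x | ⟪n, x⟫ = a}) {I : Set ℝ} (hI : MeasurableSet I) :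
    volume {x | ⟪n, x⟫ ∈ I ∧ x - ((⟪n, x⟫ - a) / ⟪n, h⟫) • h ∈ S} =
      volume I * surfaceMeasure d S := by
  have hm : MeasurableSet {x | ⟪n, x⟫ ∈ I ∧ x - ((⟪n, x⟫ - a) / ⟪n, h⟫) • h ∈ S} := by
    have h1 : Measurable fun x : EuclideanSpace ℝ (Fin d) => ⟪n, x⟫ := by fun_prop
    have h2 : Measurable fun x : EuclideanSpace ℝ (Fin d) =>
        x - ((⟪n, x⟫ - a) / ⟪n, h⟫) • h := by fun_prop
    exact (h1 hI).inter (h2 hS)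
  rw [volume_eq_lintegral_surfaceMeasure hn hm, mul_comm, ← lintegral_indicator_const hI]
  refine lintegral_congr fun s => ?_
  by_cases hs : s ∈ I
  · rw [Set.indicator_of_mem hs]
    have : {x | ⟪n, x⟫ ∈ I ∧ x - ((⟪n, x⟫ - a) / ⟪n, h⟫) • h ∈ S} ∩ {x | ⟪n, x⟫ = s} =
        (((s - a) / ⟪n, h⟫) • h) +ᵥ S := by
      ext x
      rw [Set.mem_vadd_set_iff_neg_vadd_mem]
      simp only [Set.mem_inter_iff, Set.mem_ofPred_eq, vadd_eq_add, neg_add_eq_sub]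
      constructor
      · rintro ⟨⟨_, h2⟩, rfl⟩
        exact h2
      · intro h2
        have h3 := hSa h2
        simp only [Set.mem_ofPred_eq, inner_sub_right, inner_smul_right, div_mul_cancel₀ _ hh] at h3
        have h4 : ⟪n, x⟫ = s := by linarith
        rw [h4]
        exact ⟨⟨hs, h2⟩, rfl⟩
    rw [this, surfaceMeasure, measure_vadd]
  · rw [Set.indicator_of_notMem hs]
    convert measure_empty (μ := surfaceMeasure d)
    ext x
    simp only [Set.mem_inter_iff, Set.mem_ofPred_eq, Set.mem_empty_iff_false, iff_false]
    rintro ⟨⟨h1, _⟩, rfl⟩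
    exact hs h1

theorem volume_hyperplane {d : ℕ} {n : EuclideanSpace ℝ (Fin d)} (hn : ‖n‖ = 1) (a : ℝ) :
    volume {x : EuclideanSpace ℝ (Fin d) | ⟪n, x⟫ = a} = 0 := by
  have h1 : Measurable fun x : EuclideanSpace ℝ (Fin d) => ⟪n, x⟫ := by fun_prop
  have hm : MeasurableSet {x : EuclideanSpace ℝ (Fin d) | ⟪n, x⟫ = a} :=
    h1 (measurableSet_singleton a)
  rw [volume_eq_lintegral_surfaceMeasure hn hm, lintegral_eq_zero_of_ae_eq_zero]
  have : ∀ᵐ s : ℝ, s ≠ a := by simp [ae_iff]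
  filter_upwards [this] with s hs
  rw [Pi.zero_apply]
  convert measure_empty (μ := surfaceMeasure d)
  ext x
  simp only [Set.mem_inter_iff, Set.mem_ofPred_eq, Set.mem_empty_iff_false, iff_false]
  rintro ⟨h1, rfl⟩
  exact hs h1

/-- The right cylinder over `S` of height one is bounded, and its volume is the surface measure of
`S`. -/
theorem surfaceMeasure_lt_top {d : ℕ} {n : EuclideanSpace ℝ (Fin d)} (hn : ‖n‖ = 1) {a : ℝ}
    {S : Set (EuclideanSpace ℝ (Fin d))} (hS : MeasurableSet S) (hSa : S ⊆ {x | ⟪n, x⟫ = a})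
    (hb : Bornology.IsBounded S) : surfaceMeasure d S < ∞ := by
  have hnn : ⟪n, n⟫ = 1 := by simp [hn]
  have h := volume_obliqueCylinder (h := n) hn (by rw [hnn]; exact one_ne_zero) hS hSa
    (measurableSet_Icc (a := (0 : ℝ)) (b := 1))
  rw [Real.volume_Icc, sub_zero, ENNReal.ofReal_one, one_mul] at h
  rw [← h]
  obtain ⟨R, hR⟩ := hb.exists_norm_le
  refine (measure_mono (t := Metric.closedBall 0 (R + (1 + |a|))) ?_).trans_lt
    Metric.isBounded_closedBall.measure_lt_top
  rintro x ⟨hx, hxS⟩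
  have h1 := hR _ hxS
  rw [hnn, div_one] at h1
  rw [mem_closedBall_zero_iff]
  calc ‖x‖ = ‖(x - (⟪n, x⟫ - a) • n) + (⟪n, x⟫ - a) • n‖ := by simp
    _ ≤ ‖x - (⟪n, x⟫ - a) • n‖ + ‖(⟪n, x⟫ - a) • n‖ := norm_add_le _ _
    _ ≤ R + (1 + |a|) := by
      gcongr
      rw [norm_smul, hn, mul_one, Real.norm_eq_abs]
      have := abs_sub ⟪n, x⟫ a
      have h2 : |⟪n, x⟫| ≤ 1 := abs_le.2 ⟨by linarith [hx.1], hx.2⟩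
      linarith

/-! ### Volume of truncated cones -/

/-- The part of the cone over `S` with apex `z` that lies between the homothetic copies of `S` of
ratios `1 / 2` and `1`, where `S` lies on the hyperplane of equation `⟪n, x⟫ = a`. -/
def truncatedCone {d : ℕ} (z n : EuclideanSpace ℝ (Fin d)) (a : ℝ)
    (S : Set (EuclideanSpace ℝ (Fin d))) : Set (EuclideanSpace ℝ (Fin d)) :=
  {x | (⟪n, x⟫ - ⟪n, z⟫) / (a - ⟪n, z⟫) ∈ Set.Ioo (1 / 2 : ℝ) 1 ∧
    z + ((⟪n, x⟫ - ⟪n, z⟫) / (a - ⟪n, z⟫))⁻¹ • (x - z) ∈ S}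

theorem measurableSet_truncatedCone {d : ℕ} (z n : EuclideanSpace ℝ (Fin d)) (a : ℝ)
    {S : Set (EuclideanSpace ℝ (Fin d))} (hS : MeasurableSet S) :
    MeasurableSet (truncatedCone z n a S) := by
  have h1 : Measurable fun x : EuclideanSpace ℝ (Fin d) =>
      (⟪n, x⟫ - ⟪n, z⟫) / (a - ⟪n, z⟫) := by fun_prop
  have h2 : Measurable fun x : EuclideanSpace ℝ (Fin d) =>
      z + ((⟪n, x⟫ - ⟪n, z⟫) / (a - ⟪n, z⟫))⁻¹ • (x - z) := by fun_prop
  exact (h1 measurableSet_Ioo).inter (h2 hS)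

/-- The slice of the cone at ratio `t` is a homothetic copy of `S`, of measure `t^(d-1)` times that
of `S`. Keeping only `t > 1/2` bounds this factor below by `2^(1-d)` on an interval of heights of
length `|⟪n, z⟫ - a| / 2`. The constant `2^d` is cruder than the exact constant `d` of the full
cone, but it suffices. -/
theorem surfaceMeasure_le_volume_truncatedCone {d : ℕ} (hd : 1 ≤ d)
    {z n : EuclideanSpace ℝ (Fin d)} (hn : ‖n‖ = 1) {a : ℝ} (hz : ⟪n, z⟫ ≠ a)
    {S : Set (EuclideanSpace ℝ (Fin d))} (hS : MeasurableSet S) (hSa : S ⊆ {x | ⟪n, x⟫ = a}) :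
    surfaceMeasure d S * ENNReal.ofReal |⟪n, z⟫ - a| ≤ 2 ^ d * volume (truncatedCone z n a S) := by
  set b := ⟪n, z⟫ with hb
  have hab : a - b ≠ 0 := sub_ne_zero.2 (Ne.symm hz)
  set I : Set ℝ := (fun s : ℝ => (s - b) / (a - b)) ⁻¹' Set.Ioo (1 / 2 : ℝ) 1 with hI
  have hIm : MeasurableSet I := by
    have : Measurable fun s : ℝ => (s - b) / (a - b) := by fun_prop
    exact this measurableSet_Ioo
  have hIv : volume I = ENNReal.ofReal |b - a| * ENNReal.ofReal (1 / 2) := by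
    have : I = (fun s : ℝ => s + -b) ⁻¹' ((fun s => (a - b)⁻¹ * s) ⁻¹' Set.Ioo (1 / 2 : ℝ) 1) := by
      ext s
      simp [hI, div_eq_inv_mul, sub_eq_add_neg]
    rw [this, measure_preimage_add_right, Real.volume_preimage_mul_left (inv_ne_zero hab), inv_inv,
      Real.volume_Ioo, abs_sub_comm]
    norm_num
  have hsec : ∀ s ∈ I, (2 : ℝ≥0∞)⁻¹ ^ (d - 1) * surfaceMeasure d S ≤
      surfaceMeasure d (truncatedCone z n a S ∩ {x | ⟪n, x⟫ = s}) := by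
    intro s hs
    set t := (s - b) / (a - b) with ht
    have ht0 : 0 < t := lt_trans (by norm_num) hs.1
    have hsub : AffineMap.homothety z t '' S ⊆ truncatedCone z n a S ∩ {x | ⟪n, x⟫ = s} := by
      rintro _ ⟨y, hy, rfl⟩
      have h1 : ⟪n, AffineMap.homothety z t y⟫ = s := by
        have h2 : ⟪n, y⟫ = a := hSa hy
        simp only [AffineMap.homothety_apply, vsub_eq_sub, vadd_eq_add, inner_add_right,
          inner_smul_right, inner_sub_right, h2, ← hb]
        rw [ht, div_mul_cancel₀ _ hab]
        ring
      refine ⟨?_, h1⟩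
      rw [truncatedCone, Set.mem_ofPred_eq, h1, ← hb, ← ht]
      refine ⟨hs, ?_⟩
      simpa [AffineMap.homothety_apply, smul_smul, inv_mul_cancel₀ ht0.ne'] using hy
    refine le_trans ?_ (measure_mono hsub)
    rw [surfaceMeasure, euclideanHausdorffMeasure_homothety_image _ _ ht0.ne', ENNReal.smul_def,
      smul_eq_mul, ENNReal.coe_pow]
    gcongr
    rw [← ENNReal.coe_ofNat, ← ENNReal.coe_inv (by norm_num), ENNReal.coe_le_coe,
      ← NNReal.coe_le_coe, coe_nnnorm, Real.norm_of_nonneg ht0.le]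
    have := hs.1.le
    norm_num at this ⊢
    exact this
  have hlow : volume I * ((2 : ℝ≥0∞)⁻¹ ^ (d - 1) * surfaceMeasure d S) ≤
      volume (truncatedCone z n a S) := by
    rw [volume_eq_lintegral_surfaceMeasure hn (measurableSet_truncatedCone z n a hS), mul_comm,
      ← lintegral_indicator_const hIm]
    refine lintegral_mono fun s => ?_
    by_cases hs : s ∈ I
    · rw [Set.indicator_of_mem hs]
      exact hsec s hs
    · rw [Set.indicator_of_notMem hs]
      exact zero_le
  have h2 : (2 : ℝ≥0∞) ^ d * ((2 : ℝ≥0∞)⁻¹ * (2 : ℝ≥0∞)⁻¹ ^ (d - 1)) = 1 := by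
    rw [← pow_succ', Nat.sub_add_cancel hd, ← mul_pow, ENNReal.mul_inv_cancel (by simp) (by simp),
      one_pow]
  have h3 : ENNReal.ofReal (1 / 2) = (2 : ℝ≥0∞)⁻¹ := by
    rw [one_div, ENNReal.ofReal_inv_of_pos (by norm_num)]
    simp
  calc surfaceMeasure d S * ENNReal.ofReal |b - a|
      = (2 : ℝ≥0∞) ^ d * ((2 : ℝ≥0∞)⁻¹ * (2 : ℝ≥0∞)⁻¹ ^ (d - 1)) *
        (surfaceMeasure d S * ENNReal.ofReal |b - a|) := by rw [h2, one_mul]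
    _ = 2 ^ d * (volume I * ((2 : ℝ≥0∞)⁻¹ ^ (d - 1) * surfaceMeasure d S)) := by
      rw [hIv, h3]
      ring
    _ ≤ _ := by gcongr

/-! ### Equations of hyperplanes -/

theorem exists_unit_normal {d : ℕ} {H : AffineSubspace ℝ (EuclideanSpace ℝ (Fin d))}
    (hH : Module.finrank ℝ H.direction + 1 = d) {q : EuclideanSpace ℝ (Fin d)} (hq : q ∈ H) :
    ∃ (n : EuclideanSpace ℝ (Fin d)) (a : ℝ), ‖n‖ = 1 ∧
      (H : Set (EuclideanSpace ℝ (Fin d))) = {x | ⟪n, x⟫ = a} := by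
  have h1 : Module.finrank ℝ H.directionᗮ = 1 := by
    have := H.direction.finrank_add_finrank_orthogonal
    rw [finrank_euclideanSpace_fin] at this
    omega
  have : Nontrivial H.directionᗮ := Module.nontrivial_of_finrank_pos (R := ℝ) (by omega)
  obtain ⟨m, hm⟩ := exists_norm_eq H.directionᗮ (zero_le_one (α := ℝ))
  refine ⟨m, ⟪(m : EuclideanSpace ℝ (Fin d)), q⟫, hm, ?_⟩
  have hm0 : (m : EuclideanSpace ℝ (Fin d)) ≠ 0 := by
    intro h
    rw [Submodule.coe_eq_zero.1 h] at hm
    simp at hm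
  have hdir : H.direction = (ℝ ∙ (m : EuclideanSpace ℝ (Fin d)))ᗮ := by
    refine Submodule.eq_of_le_of_finrank_eq ?_ ?_
    · intro v hv
      rw [Submodule.mem_orthogonal_singleton_iff_inner_right]
      exact Submodule.inner_left_of_mem_orthogonal hv m.2
    · have h2 := (ℝ ∙ (m : EuclideanSpace ℝ (Fin d))).finrank_add_finrank_orthogonal
      rw [finrank_euclideanSpace_fin, finrank_span_singleton hm0] at h2
      omega
  ext x
  have hdir' : x -ᵥ q ∈ H.direction ↔ x -ᵥ q ∈ (ℝ ∙ (m : EuclideanSpace ℝ (Fin d)))ᗮ := by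
    conv_lhs => rw [hdir]
  rw [SetLike.mem_coe, ← AffineSubspace.vsub_right_mem_direction_iff_mem hq, hdir',
    Submodule.mem_orthogonal_singleton_iff_inner_right, vsub_eq_sub, inner_sub_right, sub_eq_zero]
  rfl

theorem infDist_hyperplane {d : ℕ} {n : EuclideanSpace ℝ (Fin d)} (hn : ‖n‖ = 1) (a : ℝ)
    (z : EuclideanSpace ℝ (Fin d)) :
    Metric.infDist z {x | ⟪n, x⟫ = a} = |⟪n, z⟫ - a| := by
  have hnn : ⟪n, n⟫ = 1 := by simp [hn]
  have hmem : z - (⟪n, z⟫ - a) • n ∈ {x | ⟪n, x⟫ = a} := by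
    rw [Set.mem_ofPred_eq, inner_sub_right, inner_smul_right, hnn]
    ring
  refine le_antisymm ?_ ?_
  · refine (Metric.infDist_le_dist_of_mem hmem).trans ?_
    rw [dist_eq_norm, sub_sub_cancel, norm_smul, hn, mul_one, Real.norm_eq_abs]
  · rw [Metric.le_infDist ⟨_, hmem⟩]
    intro y hy
    have hy : ⟪n, y⟫ = a := hy
    rw [← hy, ← inner_sub_right, dist_eq_norm]
    simpa [hn] using abs_real_inner_le_norm n (z - y)

/-- A small homothety centred at a point of `U ∩ H` brings any point of `H` into `U`. Thus
`d_{K,σ}`, defined through `affineSpan ℝ σ`, can be read off the equation of the hyperplane. -/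
theorem affineSpan_isOpen_inter_hyperplane {d : ℕ} {H : AffineSubspace ℝ (EuclideanSpace ℝ (Fin d))}
    {U : Set (EuclideanSpace ℝ (Fin d))} (hU : IsOpen U)
    (hne : (U ∩ (H : Set (EuclideanSpace ℝ (Fin d)))).Nonempty) :
    affineSpan ℝ (U ∩ (H : Set (EuclideanSpace ℝ (Fin d)))) = H := by
  obtain ⟨y, hyU, hyH⟩ := hne
  refine le_antisymm (affineSpan_le.2 Set.inter_subset_right) fun x hx => ?_
  have hc : Filter.Tendsto (fun t : ℝ => AffineMap.lineMap y x t) (nhds 0) (nhds y) := by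
    have : Continuous fun t : ℝ => (AffineMap.lineMap y x t : EuclideanSpace ℝ (Fin d)) :=
      AffineMap.lineMap_continuous
    simpa using this.tendsto 0
  obtain ⟨t, ht, ht0⟩ := (((hc.eventually (hU.mem_nhds hyU)).filter_mono
    (nhdsWithin_le_nhds (s := {0}ᶜ))).and self_mem_nhdsWithin).exists
  have hy' : y ∈ affineSpan ℝ (U ∩ (H : Set (EuclideanSpace ℝ (Fin d)))) :=
    subset_affineSpan ℝ _ ⟨hyU, hyH⟩
  have ht' : AffineMap.lineMap y x t ∈ affineSpan ℝ (U ∩ (H : Set (EuclideanSpace ℝ (Fin d)))) :=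
    subset_affineSpan ℝ _ ⟨ht, AffineMap.lineMap_mem t hyH hx⟩
  have := AffineMap.lineMap_mem t⁻¹ hy' ht'
  rwa [AffineMap.lineMap_lineMap_right, inv_mul_cancel₀ ht0, AffineMap.lineMap_apply_one] at this

/-! ### Edges, and cones inside a cell -/

namespace SpaceDiscretisation

variable {d : ℕ} {Ω : Set (EuclideanSpace ℝ (Fin d))} (D : SpaceDiscretisation Ω)

theorem exists_edge_equation {σ : Set (EuclideanSpace ℝ (Fin d))} (hσ : σ ∈ D.edges) :
    ∃ (n : EuclideanSpace ℝ (Fin d)) (a : ℝ), ‖n‖ = 1 ∧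
      (affineSpan ℝ σ : Set (EuclideanSpace ℝ (Fin d))) = {x | ⟪n, x⟫ = a} ∧
      ∃ U : Set (EuclideanSpace ℝ (Fin d)), IsOpen U ∧ σ = U ∩ {x | ⟪n, x⟫ = a} := by
  obtain ⟨H, hH, U, hU, hUσ⟩ := D.edge_open_in_hyperplane σ hσ
  have hne := D.edge_nonempty σ hσ
  obtain ⟨y, hy⟩ := hne
  have hyH : y ∈ H := by
    rw [hUσ] at hy
    exact hy.2
  obtain ⟨n, a, hn, hna⟩ := exists_unit_normal hH hyH
  refine ⟨n, a, hn, ?_, U, hU, hna ▸ hUσ⟩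
  rw [hUσ, affineSpan_isOpen_inter_hyperplane hU (hUσ ▸ ⟨y, hy⟩), hna]

theorem mem_cellsOf {K σ : Set (EuclideanSpace ℝ (Fin d))} :
    K ∈ D.cellsOf σ ↔ K ∈ D.cells ∧ σ ∈ D.edgesOf K := by
  simp [cellsOf]

theorem cellsOf_nonempty {σ : Set (EuclideanSpace ℝ (Fin d))} (hσ : σ ∈ D.edges) :
    (D.cellsOf σ).Nonempty := by
  have h : {K | K ∈ D.cells ∧ σ ∈ D.edgesOf K}.ncard ≠ 0 := by
    rcases D.edge_cells σ hσ with h | h <;> omega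
  obtain ⟨K, hK⟩ := Set.nonempty_of_ncard_ne_zero h
  exact ⟨K, D.mem_cellsOf.2 hK⟩

theorem measurableSet_edge {σ : Set (EuclideanSpace ℝ (Fin d))} (hσ : σ ∈ D.edges) :
    MeasurableSet σ := by
  obtain ⟨n, a, -, -, U, hU, rfl⟩ := D.exists_edge_equation hσ
  refine hU.measurableSet.inter (IsClosed.measurableSet ?_)
  exact isClosed_eq (by fun_prop) (by fun_prop)

theorem closure_edge_subset {σ : Set (EuclideanSpace ℝ (Fin d))} :
    closure σ ⊆ affineSpan ℝ σ :=
  closure_minimal (subset_affineSpan ℝ σ) (AffineSubspace.closed_of_finiteDimensional _)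

theorem surfaceMeasure_edge_lt_top (hb : Bornology.IsBounded Ω)
    {σ : Set (EuclideanSpace ℝ (Fin d))} (hσ : σ ∈ D.edges) : surfaceMeasure d σ < ∞ := by
  obtain ⟨n, a, hn, hspan, -⟩ := D.exists_edge_equation hσ
  exact surfaceMeasure_lt_top hn (D.measurableSet_edge hσ) (hspan ▸ subset_affineSpan ℝ σ)
    (hb.closure.subset (D.edge_subset σ hσ))

theorem volume_closure_edge {σ : Set (EuclideanSpace ℝ (Fin d))} (hσ : σ ∈ D.edges) :
    volume (closure σ) = 0 := by
  obtain ⟨n, a, hn, hspan, -⟩ := D.exists_edge_equation hσ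
  exact measure_mono_null (hspan ▸ closure_edge_subset) (volume_hyperplane hn a)

theorem frontier_subset {K : Set (EuclideanSpace ℝ (Fin d))} (hK : K ∈ D.cells) :
    frontier K ⊆ ⋃ σ ∈ D.edges, closure σ := by
  rw [D.cell_boundary K hK]
  exact Set.biUnion_subset_biUnion_left (D.edgesOf_subset K hK)

theorem volume_grid : volume (⋃ σ ∈ D.edges, closure σ) = 0 :=
  (measure_biUnion_null_iff D.edges.countable_toSet).2 fun _ hσ => D.volume_closure_edge hσ

theorem edge_subset_frontier {K σ : Set (EuclideanSpace ℝ (Fin d))} (hK : K ∈ D.cells)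
    (hσ : σ ∈ D.edgesOf K) : σ ⊆ frontier K := by
  rw [D.cell_boundary K hK]
  exact subset_closure.trans (Set.subset_biUnion_of_mem (u := fun τ => closure τ) hσ)

theorem notMem_of_mem_frontier {K : Set (EuclideanSpace ℝ (Fin d))} (hK : K ∈ D.cells)
    {y : EuclideanSpace ℝ (Fin d)} (hy : y ∈ frontier K) : y ∉ K := by
  rw [(D.cell_isOpen K hK).frontier_eq] at hy
  exact hy.2

/-- The half-open segment from the centre of a cell to a boundary point lies in the cell. -/
theorem point_add_smul_mem {K : Set (EuclideanSpace ℝ (Fin d))} (hK : K ∈ D.cells)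
    {y : EuclideanSpace ℝ (Fin d)} (hy : y ∈ frontier K) {t : ℝ} (ht0 : 0 ≤ t) (ht1 : t < 1) :
    D.point K + t • (y - D.point K) ∈ K := by
  by_contra hz
  have hstar := D.cell_starConvex K hK
  -- If the point of ratio `t` were outside `K`, star-shapedness would exclude all later ones, which
  -- still lie in `closure K`. The rest of the segment would then lie in `frontier K`, and two of
  -- its points in the closure of one edge, since edges are finite in number. The hyperplane of that
  -- edge would contain `x_K`, against `d_{K,σ} > 0`.
  have hnot : ∀ s ∈ Set.Ioo t 1, D.point K + s • (y - D.point K) ∉ K := by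
    intro s hs hsK
    have hs0 : 0 < s := ht0.trans_lt hs.1
    refine hz ?_
    have := hstar.add_smul_sub_mem hsK (t := t / s) (by positivity)
      ((div_le_one hs0).2 hs.1.le)
    rwa [add_sub_cancel_left, smul_smul, div_mul_cancel₀ _ hs0.ne'] at this
  have hcl : ∀ s ∈ Set.Ioo t 1, D.point K + s • (y - D.point K) ∈ closure K := fun s hs =>
    map_mem_closure (f := fun z => D.point K + s • (z - D.point K)) (by fun_prop)
      (frontier_subset_closure hy)
      fun z hz => hstar.add_smul_sub_mem hz (ht0.trans hs.1.le) hs.2.le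
  have hfr : ∀ s ∈ Set.Ioo t 1, ∃ σ ∈ D.edgesOf K,
      D.point K + s • (y - D.point K) ∈ closure σ := by
    intro s hs
    have : D.point K + s • (y - D.point K) ∈ frontier K := by
      rw [(D.cell_isOpen K hK).frontier_eq]
      exact ⟨hcl s hs, hnot s hs⟩
    rw [D.cell_boundary K hK] at this
    simpa using this
  choose! f hf using hfr
  obtain ⟨s, hs, s', hs', hne, heq⟩ := (Set.Ioo_infinite ht1).exists_ne_map_eq_of_mapsTo
    (f := f) (t := (D.edgesOf K : Set (Set (EuclideanSpace ℝ (Fin d)))))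
    (fun s hs => (hf s hs).1) (D.edgesOf K).finite_toSet
  have hσ := (hf s hs).1
  obtain ⟨n, a, hn, hspan, -⟩ := D.exists_edge_equation (D.edgesOf_subset K hK hσ)
  have h1 : D.point K + s • (y - D.point K) ∈ {x | ⟪n, x⟫ = a} :=
    hspan ▸ closure_edge_subset (hf s hs).2
  have h2 : D.point K + s' • (y - D.point K) ∈ {x | ⟪n, x⟫ = a} :=
    hspan ▸ closure_edge_subset (heq ▸ (hf s' hs').2)
  simp only [Set.mem_ofPred_eq, inner_add_right, inner_smul_right] at h1 h2
  have h3 : (s - s') * ⟪n, y - D.point K⟫ = 0 := by linarith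
  have h4 : ⟪n, y - D.point K⟫ = 0 := by
    rcases mul_eq_zero.1 h3 with h | h
    · exact absurd (sub_eq_zero.1 h) hne
    · exact h
  have h5 := D.dist_pos K hK _ hσ
  rw [hspan, infDist_hyperplane hn] at h5
  rw [h4] at h1
  rw [← h1] at h5
  simp at h5

theorem truncatedCone_subset {K σ : Set (EuclideanSpace ℝ (Fin d))} (hK : K ∈ D.cells)
    (hσ : σ ∈ D.edgesOf K) (n : EuclideanSpace ℝ (Fin d)) (a : ℝ) :
    truncatedCone (D.point K) n a σ ⊆ K := by
  rintro x ⟨ht, hx⟩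
  have ht0 := lt_trans one_half_pos ht.1
  have := D.point_add_smul_mem hK (D.edge_subset_frontier hK hσ hx) ht0.le ht.2
  rwa [add_sub_cancel_left, smul_smul, mul_inv_cancel₀ ht0.ne', one_smul, add_sub_cancel] at this

/-- A common point would give a point of `σ` and a point of `τ` on one ray from `x_K`. If they
differ, the nearer one is in `K` by `point_add_smul_mem`, although it is on the frontier. If they
coincide, the edges are not disjoint. -/
theorem disjoint_truncatedCone {K σ τ : Set (EuclideanSpace ℝ (Fin d))} (hK : K ∈ D.cells)
    (hσ : σ ∈ D.edgesOf K) (hτ : τ ∈ D.edgesOf K) (hne : σ ≠ τ)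
    (n m : EuclideanSpace ℝ (Fin d)) (a b : ℝ) :
    Disjoint (truncatedCone (D.point K) n a σ) (truncatedCone (D.point K) m b τ) := by
  have key : ∀ {σ τ : Set (EuclideanSpace ℝ (Fin d))}, σ ∈ D.edgesOf K → τ ∈ D.edgesOf K →
      ∀ {s t : ℝ} {x : EuclideanSpace ℝ (Fin d)}, 0 < s → s < t →
      D.point K + s⁻¹ • (x - D.point K) ∈ σ → D.point K + t⁻¹ • (x - D.point K) ∈ τ → False := by
    intro σ τ hσ hτ s t x hs hst hxσ hxτ
    have ht : 0 < t := hs.trans hst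
    have h := D.point_add_smul_mem hK (D.edge_subset_frontier hK hσ hxσ) (t := s / t)
      (by positivity) ((div_lt_one ht).2 hst)
    rw [add_sub_cancel_left, smul_smul, div_mul_eq_mul_div, mul_inv_cancel₀ hs.ne', one_div] at h
    exact D.notMem_of_mem_frontier hK (D.edge_subset_frontier hK hτ hxτ) h
  rw [Set.disjoint_left]
  rintro x ⟨hs, hxσ⟩ ⟨ht, hxτ⟩
  set s := (⟪n, x⟫ - ⟪n, D.point K⟫) / (a - ⟪n, D.point K⟫)
  set t := (⟪m, x⟫ - ⟪m, D.point K⟫) / (b - ⟪m, D.point K⟫)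
  have hs0 : 0 < s := lt_trans (by norm_num) hs.1
  have ht0 : 0 < t := lt_trans (by norm_num) ht.1
  rcases lt_trichotomy s t with h | h | h
  · exact key hσ hτ hs0 h hxσ hxτ
  · rw [h] at hxσ
    exact Set.disjoint_left.1 (D.edge_disjoint σ (D.edgesOf_subset K hK hσ) τ
      (D.edgesOf_subset K hK hτ) hne) hxσ hxτ
  · exact key hτ hσ ht0 h hxτ hxσ

theorem dist_eq_abs {K σ n : _} {a : ℝ} (hn : ‖n‖ = 1)
    (hspan : (affineSpan ℝ σ : Set (EuclideanSpace ℝ (Fin d))) = {x | ⟪n, x⟫ = a}) :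
    D.dist K σ = |⟪n, D.point K⟫ - a| := by
  rw [dist, hspan, infDist_hyperplane hn]

theorem volume_cell_lt_top (hb : Bornology.IsBounded Ω) {K : Set (EuclideanSpace ℝ (Fin d))}
    (hK : K ∈ D.cells) : volume K < ∞ :=
  (hb.subset (D.cell_subset K hK)).measure_lt_top

/-- The truncated cones over the edges of `K` are disjoint parts of `K`, and each carries its share
`|σ| d_{K,σ}` up to the factor `2^d`. -/
theorem sum_surfaceMeasure_mul_dist_le (hd : 1 ≤ d) (hb : Bornology.IsBounded Ω)
    {K : Set (EuclideanSpace ℝ (Fin d))} (hK : K ∈ D.cells) :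
    ∑ σ ∈ D.edgesOf K, (surfaceMeasure d).real σ * D.dist K σ ≤ 2 ^ d * volume.real K := by
  have hex : ∀ σ ∈ D.edgesOf K, ∃ (n : EuclideanSpace ℝ (Fin d)) (a : ℝ), ‖n‖ = 1 ∧
      (affineSpan ℝ σ : Set (EuclideanSpace ℝ (Fin d))) = {x | ⟪n, x⟫ = a} := fun σ hσ => by
    obtain ⟨n, a, hn, hspan, -⟩ := D.exists_edge_equation (D.edgesOf_subset K hK hσ)
    exact ⟨n, a, hn, hspan⟩
  choose! n a hn hspan using hex
  have hsum : ∑ σ ∈ D.edgesOf K, surfaceMeasure d σ * ENNReal.ofReal (D.dist K σ) ≤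
      2 ^ d * volume K := by
    calc ∑ σ ∈ D.edgesOf K, surfaceMeasure d σ * ENNReal.ofReal (D.dist K σ)
        ≤ ∑ σ ∈ D.edgesOf K, 2 ^ d * volume (truncatedCone (D.point K) (n σ) (a σ) σ) := by
          refine Finset.sum_le_sum fun σ hσ => ?_
          have hpos := D.dist_pos K hK σ hσ
          rw [hspan σ hσ, infDist_hyperplane (hn σ hσ), abs_pos, sub_ne_zero] at hpos
          rw [D.dist_eq_abs (hn σ hσ) (hspan σ hσ)]
          exact surfaceMeasure_le_volume_truncatedCone hd (hn σ hσ) hpos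
            (D.measurableSet_edge (D.edgesOf_subset K hK hσ))
            (hspan σ hσ ▸ subset_affineSpan ℝ σ)
      _ = 2 ^ d * volume (⋃ σ ∈ D.edgesOf K, truncatedCone (D.point K) (n σ) (a σ) σ) := by
          rw [← Finset.mul_sum, measure_biUnion_finset]
          · intro σ hσ τ hτ hne
            exact D.disjoint_truncatedCone hK hσ hτ hne _ _ _ _
          · intro σ hσ
            exact measurableSet_truncatedCone _ _ _
              (D.measurableSet_edge (D.edgesOf_subset K hK hσ))
      _ ≤ 2 ^ d * volume K := by
          gcongr
          exact Set.iUnion₂_subset fun σ hσ => D.truncatedCone_subset hK hσ _ _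
  have htop : 2 ^ d * volume K ≠ ∞ :=
    ENNReal.mul_ne_top (by simp) (D.volume_cell_lt_top hb hK).ne
  have h := ENNReal.toReal_mono htop hsum
  rw [ENNReal.toReal_sum] at h
  · simpa [measureReal_def, ENNReal.toReal_mul, ENNReal.toReal_ofReal, dist,
      Metric.infDist_nonneg] using h
  · intro σ hσ
    exact ENNReal.mul_ne_top
      (D.surfaceMeasure_edge_lt_top hb (D.edgesOf_subset K hK hσ)).ne ENNReal.ofReal_ne_top

end SpaceDiscretisation

/-! ### Points whose translation segment meets a piece of hyperplane -/

/-- The set lies in an oblique cylinder over `S` with heights in an interval of length `|⟪n, h⟫| ≤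
‖h‖`. If `h` is parallel to the hyperplane, it lies in the hyperplane itself and is negligible. -/
theorem volume_sweep_le {d : ℕ} {n : EuclideanSpace ℝ (Fin d)} (hn : ‖n‖ = 1) {a : ℝ}
    {S : Set (EuclideanSpace ℝ (Fin d))} (hS : MeasurableSet S) (hSa : S ⊆ {x | ⟪n, x⟫ = a})
    (h : EuclideanSpace ℝ (Fin d)) :
    volume {x | ∃ t ∈ Set.Icc (0 : ℝ) 1, x + t • h ∈ S} ≤
      ENNReal.ofReal ‖h‖ * surfaceMeasure d S := by
  by_cases hh : ⟪n, h⟫ = 0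
  · refine le_of_eq_of_le (measure_mono_null ?_ (volume_hyperplane hn a)) zero_le
    rintro x ⟨t, -, hx⟩
    have := hSa hx
    rwa [Set.mem_ofPred_eq, inner_add_right, inner_smul_right, hh, mul_zero, add_zero] at this
  · have hsub : {x | ∃ t ∈ Set.Icc (0 : ℝ) 1, x + t • h ∈ S} ⊆
        {x | ⟪n, x⟫ ∈ Set.uIcc (a - ⟪n, h⟫) a ∧
          x - ((⟪n, x⟫ - a) / ⟪n, h⟫) • h ∈ S} := by
      rintro x ⟨t, ht, hx⟩
      have h1 := hSa hx
      rw [Set.mem_ofPred_eq, inner_add_right, inner_smul_right] at h1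
      refine ⟨?_, ?_⟩
      · rw [← segment_eq_uIcc, segment_eq_image_lineMap]
        refine ⟨1 - t, ⟨by linarith [ht.2], by linarith [ht.1]⟩, ?_⟩
        rw [AffineMap.lineMap_apply_ring']
        linarith
      · have h2 : (⟪n, x⟫ - a) / ⟪n, h⟫ = -t := by
          rw [div_eq_iff hh]
          linarith
        rwa [h2, neg_smul, sub_neg_eq_add]
    refine (measure_mono hsub).trans ?_
    rw [volume_obliqueCylinder hn hh hS hSa measurableSet_uIcc, Real.volume_interval]
    gcongr
    rw [sub_sub_cancel]
    simpa [hn] using abs_real_inner_le_norm n h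

theorem mul_pos_iff_not_of_mul_neg {s x z : ℝ} (hs : s ≠ 0) (hxz : x * z < 0) :
    0 < s * z ↔ ¬ 0 < s * x := by
  have h : (s * x) * (s * z) < 0 := by nlinarith [mul_pos (mul_self_pos.2 hs) (neg_pos.2 hxz)]
  rcases mul_neg_iff.1 h with h | h
  · exact iff_of_false h.2.not_gt (not_not_intro h.1)
  · exact iff_of_true h.2 h.1.not_gt

/-! ### Step functions, and the cells around a regular point of an edge -/

namespace SpaceDiscretisation

variable {d : ℕ} {Ω : Set (EuclideanSpace ℝ (Fin d))} (D : SpaceDiscretisation Ω)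

/-- The function equal to `w K` on each control volume `K`, and to `0` elsewhere. -/
noncomputable def stepFun (w : Set (EuclideanSpace ℝ (Fin d)) → ℝ)
    (x : EuclideanSpace ℝ (Fin d)) : ℝ :=
  ∑ K ∈ D.cells, K.indicator (fun _ => w K) x

variable {D}

theorem stepFun_of_mem (w : Set (EuclideanSpace ℝ (Fin d)) → ℝ)
    {K : Set (EuclideanSpace ℝ (Fin d))} (hK : K ∈ D.cells) {x : EuclideanSpace ℝ (Fin d)}
    (hx : x ∈ K) : D.stepFun w x = w K := by
  rw [stepFun, Finset.sum_eq_single_of_mem K hK, Set.indicator_of_mem hx]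
  intro L hL hne
  exact Set.indicator_of_notMem
    (Set.disjoint_right.1 (D.cell_disjoint L hL K hK hne) hx) _

theorem stepFun_congr (w : Set (EuclideanSpace ℝ (Fin d)) → ℝ)
    {x y : EuclideanSpace ℝ (Fin d)} (hxy : ∀ K ∈ D.cells, x ∈ K ↔ y ∈ K) :
    D.stepFun w x = D.stepFun w y := by
  refine Finset.sum_congr rfl fun K hK => ?_
  by_cases hx : x ∈ K
  · rw [Set.indicator_of_mem hx, Set.indicator_of_mem ((hxy K hK).1 hx)]
  · rw [Set.indicator_of_notMem hx, Set.indicator_of_notMem (mt (hxy K hK).2 hx)]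

/-- Since `frontier K` is part of the grid of closed edges, `K` and the complement of its closure
are disjoint open sets that cover `A`. -/
theorem mem_cell_of_isPreconnected {K A : Set (EuclideanSpace ℝ (Fin d))} (hK : K ∈ D.cells)
    (hA : IsPreconnected A) (hgrid : ∀ x ∈ A, x ∉ ⋃ σ ∈ D.edges, closure σ)
    {x y : EuclideanSpace ℝ (Fin d)} (hx : x ∈ A) (hxK : x ∈ K) (hy : y ∈ A) : y ∈ K := by
  have hcl : ∀ z ∈ A, z ∉ K → z ∈ (closure K)ᶜ := fun z hz hzK hzc => hgrid z hz
    (D.frontier_subset hK (by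
      rw [(D.cell_isOpen K hK).frontier_eq]
      exact ⟨hzc, hzK⟩))
  by_contra hyK
  obtain ⟨z, -, hzK, hzc⟩ := hA K (closure K)ᶜ (D.cell_isOpen K hK) isClosed_closure.isOpen_compl
    (fun z hz => or_iff_not_imp_left.2 (hcl z hz)) ⟨x, hx, hxK⟩ ⟨y, hy, hcl y hy hyK⟩
  exact hzc (subset_closure hzK)

theorem exists_ball_around_edge_point {σ : Set (EuclideanSpace ℝ (Fin d))} (hσ : σ ∈ D.edges)
    {y : EuclideanSpace ℝ (Fin d)} (hy : y ∈ σ) (hreg : ∀ τ ∈ D.edges, y ∉ closure τ \ τ) :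
    ∃ r > 0, (∀ x ∈ Metric.ball y r, ∀ τ ∈ D.edges, x ∈ closure τ → τ = σ) ∧
      (∀ x ∈ Metric.ball y r, x ∈ affineSpan ℝ σ → x ∈ σ) ∧
      (∀ x ∈ Metric.ball y r, ∀ L ∈ D.cells, x ∈ closure L → y ∈ closure L) := by
  obtain ⟨n, a, hn, hspan, U, hU, hUσ⟩ := D.exists_edge_equation hσ
  have h1 : ∀ᶠ x in nhds y, ∀ τ ∈ D.edges, x ∈ closure τ → τ = σ := by
    rw [Filter.eventually_all_finset]
    intro τ hτ
    by_cases h : τ = σ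
    · exact Filter.Eventually.of_forall fun _ _ => h
    · have hyτ : y ∉ closure τ := fun hc => hreg τ hτ
        ⟨hc, Set.disjoint_right.1 (D.edge_disjoint τ hτ σ hσ h) hy⟩
      filter_upwards [isClosed_closure.isOpen_compl.mem_nhds hyτ] with x hx hx'
      exact absurd hx' hx
  have h2 : ∀ᶠ x in nhds y, x ∈ affineSpan ℝ σ → x ∈ σ := by
    have hyU : y ∈ U := by
      rw [hUσ] at hy
      exact hy.1
    filter_upwards [hU.mem_nhds hyU] with x hx hx'
    rw [hUσ]
    refine ⟨hx, ?_⟩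
    rw [← hspan]
    exact hx'
  have h3 : ∀ᶠ x in nhds y, ∀ L ∈ D.cells, x ∈ closure L → y ∈ closure L := by
    rw [Filter.eventually_all_finset]
    intro L hL
    by_cases h : y ∈ closure L
    · exact Filter.Eventually.of_forall fun _ _ => h
    · filter_upwards [isClosed_closure.isOpen_compl.mem_nhds h] with x hx hx'
      exact absurd hx' hx
  obtain ⟨r, hr, hball⟩ := Metric.eventually_nhds_iff_ball.1 (h1.and (h2.and h3))
  exact ⟨r, hr, fun x hx => (hball x hx).1, fun x hx => (hball x hx).2.1,
    fun x hx => (hball x hx).2.2⟩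

theorem exists_norm_smul_lt (v : EuclideanSpace ℝ (Fin d)) {r : ℝ} (hr : 0 < r) :
    ∃ ε : ℝ, 0 < ε ∧ ε < 1 ∧ ‖ε • v‖ < r := by
  have hc : Filter.Tendsto (fun t : ℝ => ‖t • v‖) (nhdsWithin 0 (Set.Ioi 0)) (nhds 0) := by
    have : Continuous fun t : ℝ => ‖t • v‖ := by fun_prop
    simpa using (this.tendsto 0).mono_left (nhdsWithin_le_nhds (s := Set.Ioi 0))
  obtain ⟨ε, h1, h2⟩ := ((hc.eventually (gt_mem_nhds hr)).and
    (Ioo_mem_nhdsGT (zero_lt_one (α := ℝ)))).exists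
  exact ⟨ε, h2.1, h2.2, h1⟩

/-- Near a regular point of an edge of `K`, the cell `K` is the side of the edge that contains the
centre of `K`. -/
theorem mem_cell_iff_of_mem_ball {K σ : Set (EuclideanSpace ℝ (Fin d))} (hK : K ∈ D.cells)
    (hσ : σ ∈ D.edgesOf K) {n : EuclideanSpace ℝ (Fin d)} {a : ℝ} (hn : ‖n‖ = 1)
    (hspan : (affineSpan ℝ σ : Set (EuclideanSpace ℝ (Fin d))) = {x | ⟪n, x⟫ = a})
    {y : EuclideanSpace ℝ (Fin d)} (hy : y ∈ σ) {r : ℝ} (hr : 0 < r)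
    (hball : ∀ x ∈ Metric.ball y r, ∀ τ ∈ D.edges, x ∈ closure τ → τ = σ)
    {x : EuclideanSpace ℝ (Fin d)} (hx : x ∈ Metric.ball y r) (hxa : ⟪n, x⟫ ≠ a) :
    x ∈ K ↔ 0 < (⟪n, D.point K⟫ - a) * (⟪n, x⟫ - a) := by
  set s := ⟪n, D.point K⟫ - a with hs
  have hya : ⟪n, y⟫ = a := by
    have : y ∈ {x | ⟪n, x⟫ = a} := hspan ▸ subset_affineSpan ℝ σ hy
    exact this
  have hyfr : y ∈ frontier K := D.edge_subset_frontier hK hσ hy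
  have hs0 : s ≠ 0 := by
    have := D.dist_pos K hK σ hσ
    rwa [hspan, infDist_hyperplane hn, abs_pos] at this
  have hconv : ∀ c : ℝ, Convex ℝ {x | x ∈ Metric.ball y r ∧ 0 < c * (⟪n, x⟫ - a)} := by
    intro c
    have h1 : IsLinearMap ℝ fun x : EuclideanSpace ℝ (Fin d) => c * ⟪n, x⟫ :=
      ⟨fun x z => by rw [inner_add_right]; ring,
        fun t x => by rw [inner_smul_right, smul_eq_mul]; ring⟩
    have h2 := (convex_ball y r).inter (convex_halfSpace_gt (𝕜 := ℝ) h1 (c * a))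
    have h3 : {x | x ∈ Metric.ball y r ∧ 0 < c * (⟪n, x⟫ - a)} =
        Metric.ball y r ∩ {w | c * a < c * ⟪n, w⟫} := by
      ext x
      simp only [Set.mem_ofPred_eq, Set.mem_inter_iff, mul_sub, sub_pos]
    rw [h3]
    exact h2
  have hgrid : ∀ c : ℝ, ∀ x ∈ {x | x ∈ Metric.ball y r ∧ 0 < c * (⟪n, x⟫ - a)},
      x ∉ ⋃ τ ∈ D.edges, closure τ := by
    rintro c x ⟨hx, hc⟩ hmem
    simp only [Set.mem_iUnion, exists_prop] at hmem
    obtain ⟨τ, hτ, hxτ⟩ := hmem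
    rw [hball x hx τ hτ hxτ] at hxτ
    have : x ∈ {x | ⟪n, x⟫ = a} := hspan ▸ closure_edge_subset hxτ
    rw [Set.mem_ofPred_eq] at this
    rw [this, sub_self, mul_zero] at hc
    exact lt_irrefl _ hc
  obtain ⟨ε, hε0, hε1, hεr⟩ := exists_norm_smul_lt (y - D.point K) hr
  constructor
  -- If `x` were in `K` on the side away from `x_K`, that whole half-ball would be in `K`, including
  -- a point just beyond `y` on the ray from `x_K`. Star-shapedness would then put `y` in `K`.
  · intro hxK
    by_contra hneg
    have hx0 : 0 < -s * (⟪n, x⟫ - a) := by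
      rcases lt_or_eq_of_le (not_lt.1 hneg) with h | h
      · linarith
      · rcases mul_eq_zero.1 h with h | h
        · exact absurd h hs0
        · exact absurd (sub_eq_zero.1 h) hxa
    have hfar : y + ε • (y - D.point K) ∈ K := by
      refine mem_cell_of_isPreconnected hK (hconv (-s)).isPreconnected (hgrid (-s)) ⟨hx, hx0⟩
        hxK ⟨?_, ?_⟩
      · rwa [Metric.mem_ball, dist_eq_norm, add_sub_cancel_left]
      · rw [inner_add_right, inner_smul_right, inner_sub_right, hya]
        have : -s * (a + ε * (a - ⟪n, D.point K⟫) - a) = ε * (s * s) := by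
          rw [hs]
          ring
        rw [this]
        have := mul_self_pos.2 hs0
        positivity
    have h1 : 0 < 1 + ε := by linarith
    have hyK := (D.cell_starConvex K hK).add_smul_sub_mem hfar (t := (1 + ε)⁻¹)
      (by positivity) (inv_le_one_of_one_le₀ (by linarith))
    have h2 : D.point K + (1 + ε)⁻¹ • (y + ε • (y - D.point K) - D.point K) = y := by
      have h3 : y + ε • (y - D.point K) - D.point K = (1 + ε) • (y - D.point K) := by
        rw [add_smul, one_smul]
        abel
      rw [h3, smul_smul, inv_mul_cancel₀ h1.ne', one_smul, add_sub_cancel]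
    rw [h2] at hyK
    exact D.notMem_of_mem_frontier hK hyfr hyK
  -- The point just before `y` on the segment from `x_K` is in `K`, and the half-ball that contains
  -- it is off the grid.
  · intro hpos
    have hnear := D.point_add_smul_mem hK hyfr (t := 1 - ε) (by linarith) (by linarith)
    have h2 : D.point K + (1 - ε) • (y - D.point K) = y - ε • (y - D.point K) := by
      rw [sub_smul, one_smul]
      abel
    rw [h2] at hnear
    refine mem_cell_of_isPreconnected hK (hconv s).isPreconnected (hgrid s) ⟨?_, ?_⟩
        hnear ⟨hx, hpos⟩
    · rwa [Metric.mem_ball, dist_eq_norm, sub_sub_cancel_left, norm_neg]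
    · rw [inner_sub_right, inner_smul_right, inner_sub_right, hya]
      have : s * (a - ε * (a - ⟪n, D.point K⟫) - a) = ε * (s * s) := by
        rw [hs]
        ring
      rw [this]
      have := mul_self_pos.2 hs0
      positivity

open Classical in
/-- `J` bounds the jumps across the edges of the piecewise constant function of cell values `w`. -/
def BoundsJumps (D : SpaceDiscretisation Ω) (w J : Set (EuclideanSpace ℝ (Fin d)) → ℝ) : Prop :=
  ∀ σ ∈ D.edges, ∀ K ∈ D.cellsOf σ, |w K - ∑ L ∈ (D.cellsOf σ).erase K, w L| ≤ J σ

theorem BoundsJumps.nonneg {w J : Set (EuclideanSpace ℝ (Fin d)) → ℝ} (hJ : D.BoundsJumps w J)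
    {σ : Set (EuclideanSpace ℝ (Fin d))} (hσ : σ ∈ D.edges) : 0 ≤ J σ := by
  obtain ⟨K, hK⟩ := D.cellsOf_nonempty hσ
  exact (abs_nonneg _).trans (hJ σ hσ K hK)

open Classical in
-- Near a regular point, `σ` cuts the ball into two halves, and only the cells of `σ` can meet them.
-- Points of the same half belong to the same cells. On opposite halves the values are `w K` and the
-- sum over the remaining cells of `σ`, which has one term at an interior edge and none at a
-- boundary edge; both kinds of edges are thus handled together.
theorem BoundsJumps.exists_ball {w J : Set (EuclideanSpace ℝ (Fin d)) → ℝ}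
    (hJ : D.BoundsJumps w J) {σ : Set (EuclideanSpace ℝ (Fin d))} (hσ : σ ∈ D.edges)
    {y : EuclideanSpace ℝ (Fin d)} (hy : y ∈ σ) (hreg : ∀ τ ∈ D.edges, y ∉ closure τ \ τ) :
    ∃ r > 0, (∀ x ∈ Metric.ball y r, x ∈ ⋃ τ ∈ D.edges, closure τ → x ∈ closure σ) ∧
      ∀ x ∈ Metric.ball y r, ∀ z ∈ Metric.ball y r, x ∉ ⋃ τ ∈ D.edges, closure τ →
        z ∉ ⋃ τ ∈ D.edges, closure τ → |D.stepFun w x - D.stepFun w z| ≤ J σ := by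
  obtain ⟨r, hr, hb1, hb2, hb3⟩ := exists_ball_around_edge_point hσ hy hreg
  obtain ⟨n, a, hn, hspan, -⟩ := D.exists_edge_equation hσ
  refine ⟨r, hr, ?_, ?_⟩
  · intro x hx hmem
    simp only [Set.mem_iUnion, exists_prop] at hmem
    obtain ⟨τ, hτ, hxτ⟩ := hmem
    rwa [hb1 x hx τ hτ hxτ] at hxτ
  have hside : ∀ {x : EuclideanSpace ℝ (Fin d)}, x ∈ Metric.ball y r →
      x ∉ ⋃ τ ∈ D.edges, closure τ → ⟪n, x⟫ ≠ a := by
    intro x hx hxg hxa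
    refine hxg (Set.mem_biUnion hσ (subset_closure (hb2 x hx ?_)))
    rw [← SetLike.mem_coe, hspan]
    exact hxa
  -- The closure of such a cell `L` would contain `y`, which is not in `L`, as `y` is in the closure
  -- of a cell disjoint from the open set `L`. So `y` would be on the frontier of `L`, hence in a
  -- closed edge of `L`, and by the choice of the ball this edge can only be `σ`.
  have hother : ∀ {x L : _}, x ∈ Metric.ball y r → L ∈ D.cells → L ∉ D.cellsOf σ → x ∉ L := by
    intro x L hx hL hLσ hxL
    obtain ⟨K, hK⟩ := D.cellsOf_nonempty hσ
    have hne : L ≠ K := fun h => hLσ (h ▸ hK)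
    rw [D.mem_cellsOf] at hK hLσ
    have hyK := frontier_subset_closure (D.edge_subset_frontier hK.1 hK.2 hy)
    have hyL := hb3 x hx L hL (subset_closure hxL)
    have hyL' : y ∉ L := Set.disjoint_right.1
      ((D.cell_disjoint L hL K hK.1 hne).closure_right (D.cell_isOpen L hL)) hyK
    have hfr : y ∈ frontier L := by
      rw [(D.cell_isOpen L hL).frontier_eq]
      exact ⟨hyL, hyL'⟩
    rw [D.cell_boundary L hL] at hfr
    simp only [Set.mem_iUnion, exists_prop] at hfr
    obtain ⟨τ, hτ, hyτ⟩ := hfr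
    have := hb1 y (Metric.mem_ball_self hr) τ (D.edgesOf_subset L hL hτ) hyτ
    exact hLσ ⟨hL, this ▸ hτ⟩
  have hmem : ∀ {x K : _}, x ∈ Metric.ball y r → x ∉ ⋃ τ ∈ D.edges, closure τ →
      K ∈ D.cellsOf σ → (x ∈ K ↔ 0 < (⟪n, D.point K⟫ - a) * (⟪n, x⟫ - a)) := by
    intro x K hx hxg hK
    rw [D.mem_cellsOf] at hK
    exact mem_cell_iff_of_mem_ball hK.1 hK.2 hn hspan hy hr hb1 hx (hside hx hxg)
  have hmain : ∀ {x z K : _}, x ∈ Metric.ball y r → z ∈ Metric.ball y r →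
      x ∉ ⋃ τ ∈ D.edges, closure τ → z ∉ ⋃ τ ∈ D.edges, closure τ →
      (⟪n, x⟫ - a) * (⟪n, z⟫ - a) < 0 → K ∈ D.cellsOf σ → x ∈ K →
      |D.stepFun w x - D.stepFun w z| ≤ J σ := by
    intro x z K hx hz hxg hzg hxz hK hxK
    have hKc := (D.mem_cellsOf.1 hK).1
    have hz' : D.stepFun w z = ∑ L ∈ (D.cellsOf σ).erase K, w L := by
      have hsub : (D.cellsOf σ).erase K ⊆ D.cells := fun L hL =>
        (D.mem_cellsOf.1 (Finset.mem_of_mem_erase hL)).1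
      rw [stepFun, ← Finset.sum_subset hsub]
      · refine Finset.sum_congr rfl fun L hL => Set.indicator_of_mem ?_ _
        obtain ⟨hne, hL⟩ := Finset.mem_erase.1 hL
        -- As `x` is in `K`, it is not in `L`; so the centre of `L` is on the side of `z`, and `z`
        -- is in `L`.
        have hxL : x ∉ L := Set.disjoint_right.1
          (D.cell_disjoint L (D.mem_cellsOf.1 hL).1 K hKc hne) hxK
        rw [hmem hx hxg hL] at hxL
        rw [hmem hz hzg hL]
        have hs0 : ⟪n, D.point L⟫ - a ≠ 0 := by
          have := D.dist_pos L (D.mem_cellsOf.1 hL).1 σ (D.mem_cellsOf.1 hL).2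
          rwa [hspan, infDist_hyperplane hn, abs_pos] at this
        exact (mul_pos_iff_not_of_mul_neg hs0 hxz).2 hxL
      · intro L hL hnot
        refine Set.indicator_of_notMem ?_ _
        by_cases hLσ : L ∈ D.cellsOf σ
        · have hLK : L = K := by
            by_contra h
            exact hnot (Finset.mem_erase.2 ⟨h, hLσ⟩)
          rw [hLK, hmem hz hzg hK]
          rw [hmem hx hxg hK] at hxK
          intro h
          nlinarith [mul_pos hxK h, mul_self_nonneg (⟪n, D.point K⟫ - a)]
        · exact hother hz hL hLσ
    rw [stepFun_of_mem w hKc hxK, hz']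
    exact hJ σ hσ K hK
  intro x hx z hz hxg hzg
  have hx0 := sub_ne_zero.2 (hside hx hxg)
  have hz0 := sub_ne_zero.2 (hside hz hzg)
  rcases lt_or_gt_of_ne (mul_ne_zero hx0 hz0) with hxz | hxz
  · obtain ⟨K, hK⟩ := D.cellsOf_nonempty hσ
    by_cases hxK : x ∈ K
    · exact hmain hx hz hxg hzg hxz hK hxK
    · rw [abs_sub_comm]
      refine hmain hz hx hzg hxg (by rwa [mul_comm]) hK ?_
      rw [hmem hx hxg hK] at hxK
      rw [hmem hz hzg hK]
      have hs0 : ⟪n, D.point K⟫ - a ≠ 0 := by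
        have := D.dist_pos K (D.mem_cellsOf.1 hK).1 σ (D.mem_cellsOf.1 hK).2
        rwa [hspan, infDist_hyperplane hn, abs_pos] at this
      exact (mul_pos_iff_not_of_mul_neg hs0 hxz).2 hxK
  · have : D.stepFun w x = D.stepFun w z := by
      refine stepFun_congr w fun L hL => ?_
      by_cases hLσ : L ∈ D.cellsOf σ
      · rw [hmem hx hxg hLσ, hmem hz hzg hLσ]
        constructor
        · intro h
          by_contra hc
          nlinarith [mul_pos h hxz, mul_self_pos.2 hx0]
        · intro h
          by_contra hc
          nlinarith [mul_pos h hxz, mul_self_pos.2 hz0]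
      · exact iff_of_false (hother hx hL hLσ) (hother hz hL hLσ)
    rw [this, sub_self, abs_zero]
    exact hJ.nonneg hσ

end SpaceDiscretisation

/-! ### Variation along segments, and the translation estimate -/

namespace SpaceDiscretisation

variable {d : ℕ} {Ω : Set (EuclideanSpace ℝ (Fin d))} {D : SpaceDiscretisation Ω}

open Classical in
/-- Along a segment that meets each edge at most once and avoids the relative boundaries of the
edges, a step function varies at most by the sum of the jumps over the edges that are met. -/
theorem BoundsJumps.abs_stepFun_sub_le {w J : Set (EuclideanSpace ℝ (Fin d)) → ℝ}
    (hJ : D.BoundsJumps w J) {x h : EuclideanSpace ℝ (Fin d)}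
    (honce : ∀ σ ∈ D.edges, ∀ s t : ℝ, x + s • h ∈ closure σ → x + t • h ∈ closure σ → s = t)
    {a b : ℝ} (hab : a ≤ b)
    (hreg : ∀ t ∈ Set.Icc a b, ∀ σ ∈ D.edges, x + t • h ∉ closure σ \ σ)
    (ha : x + a • h ∉ ⋃ σ ∈ D.edges, closure σ) (hb : x + b • h ∉ ⋃ σ ∈ D.edges, closure σ) :
    |D.stepFun w (x + b • h) - D.stepFun w (x + a • h)| ≤
      ∑ σ ∈ D.edges with ∃ t ∈ Set.Ioo a b, x + t • h ∈ σ, J σ := by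
  -- Induction on the number of edges met. One crossing is isolated by two nearby parameters `s₁ < t
  -- < s₂`. As each edge is met at most once, the two outer segments meet disjoint sets of edges,
  -- none of them the isolated one.
  induction hm : (D.edges.filter fun σ => ∃ t ∈ Set.Ioo a b, x + t • h ∈ σ).card
    using Nat.strong_induction_on generalizing a b with
  | _ m ih =>
  have hJ0 : ∀ (c e : ℝ), ∀ σ ∈ D.edges.filter fun σ => ∃ t ∈ Set.Ioo c e, x + t • h ∈ σ,
      0 ≤ J σ := fun c e σ hσ => hJ.nonneg (Finset.mem_filter.1 hσ).1
  rcases (D.edges.filter fun σ => ∃ t ∈ Set.Ioo a b, x + t • h ∈ σ).eq_empty_or_nonempty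
    with hemp | ⟨σ, hσT⟩
  · have hgrid : ∀ z ∈ (fun t : ℝ => x + t • h) '' Set.Icc a b,
        z ∉ ⋃ σ ∈ D.edges, closure σ := by
      rintro _ ⟨t, ht, rfl⟩ hmem
      rcases eq_or_lt_of_le ht.1 with rfl | hat
      · exact ha hmem
      rcases eq_or_lt_of_le ht.2 with rfl | htb
      · exact hb hmem
      simp only [Set.mem_iUnion, exists_prop] at hmem
      obtain ⟨σ, hσ, htσ⟩ := hmem
      have hσ' : x + t • h ∈ σ := by
        by_contra hn
        exact hreg t ht σ hσ ⟨htσ, hn⟩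
      exact Finset.notMem_empty σ (hemp ▸ Finset.mem_filter.2 ⟨hσ, t, ⟨hat, htb⟩, hσ'⟩)
    have hpre : IsPreconnected ((fun t : ℝ => x + t • h) '' Set.Icc a b) :=
      isPreconnected_Icc.image _ (by fun_prop)
    have hma := Set.mem_image_of_mem (fun t : ℝ => x + t • h) (Set.left_mem_Icc.2 hab)
    have hmb := Set.mem_image_of_mem (fun t : ℝ => x + t • h) (Set.right_mem_Icc.2 hab)
    have := stepFun_congr (D := D) w (x := x + b • h) (y := x + a • h) fun K hK =>
      ⟨fun hK' => mem_cell_of_isPreconnected hK hpre hgrid hmb hK' hma,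
        fun hK' => mem_cell_of_isPreconnected hK hpre hgrid hma hK' hmb⟩
    rw [this, sub_self, abs_zero]
    exact Finset.sum_nonneg (hJ0 a b)
  obtain ⟨hσ, t, ht, htσ⟩ := Finset.mem_filter.1 hσT
  obtain ⟨r, hr, hball, hjump⟩ := hJ.exists_ball hσ htσ (hreg t ⟨ht.1.le, ht.2.le⟩)
  obtain ⟨s₁, s₂, has₁, hs₁t, hts₂, hs₂b, hs₁r, hs₂r⟩ : ∃ s₁ s₂ : ℝ, a < s₁ ∧ s₁ < t ∧ t < s₂ ∧
      s₂ < b ∧ x + s₁ • h ∈ Metric.ball (x + t • h) r ∧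
      x + s₂ • h ∈ Metric.ball (x + t • h) r := by
    have hc : Continuous fun s : ℝ => x + s • h := by fun_prop
    have hev : ∀ᶠ s in nhds t, x + s • h ∈ Metric.ball (x + t • h) r :=
      hc.tendsto t (Metric.ball_mem_nhds _ hr)
    obtain ⟨s₁, h₁, h₁'⟩ := ((hev.filter_mono nhdsWithin_le_nhds).and
      (Ioo_mem_nhdsLT ht.1)).exists
    obtain ⟨s₂, h₂, h₂'⟩ := ((hev.filter_mono nhdsWithin_le_nhds).and
      (Ioo_mem_nhdsGT ht.2)).exists
    exact ⟨s₁, s₂, h₁'.1, h₁'.2, h₂'.1, h₂'.2, h₁, h₂⟩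
  have hg₁ : x + s₁ • h ∉ ⋃ σ ∈ D.edges, closure σ := fun hmem =>
    hs₁t.ne (honce σ hσ _ _ (hball _ hs₁r hmem) (subset_closure htσ))
  have hg₂ : x + s₂ • h ∉ ⋃ σ ∈ D.edges, closure σ := fun hmem =>
    hts₂.ne' (honce σ hσ _ _ (hball _ hs₂r hmem) (subset_closure htσ))
  set T := D.edges.filter fun σ => ∃ t ∈ Set.Ioo a b, x + t • h ∈ σ with hT
  set T₁ := D.edges.filter fun σ => ∃ t ∈ Set.Ioo a s₁, x + t • h ∈ σ with hT₁
  set T₂ := D.edges.filter fun σ => ∃ t ∈ Set.Ioo s₂ b, x + t • h ∈ σ with hT₂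
  have hT₁T : T₁ ⊆ T.erase σ := by
    intro τ hτ
    obtain ⟨hτ, s, hs, hsτ⟩ := Finset.mem_filter.1 hτ
    refine Finset.mem_erase.2 ⟨?_, Finset.mem_filter.2 ⟨hτ, s, ⟨hs.1, by linarith [hs.2]⟩, hsτ⟩⟩
    rintro rfl
    have := honce τ hτ _ _ (subset_closure hsτ) (subset_closure htσ)
    linarith [hs.2]
  have hT₂T : T₂ ⊆ T.erase σ := by
    intro τ hτ
    obtain ⟨hτ, s, hs, hsτ⟩ := Finset.mem_filter.1 hτ
    refine Finset.mem_erase.2 ⟨?_, Finset.mem_filter.2 ⟨hτ, s, ⟨by linarith [hs.1], hs.2⟩, hsτ⟩⟩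
    rintro rfl
    have := honce τ hτ _ _ (subset_closure hsτ) (subset_closure htσ)
    linarith [hs.1]
  have hdisj : Disjoint T₁ T₂ := by
    rw [Finset.disjoint_left]
    intro τ hτ₁ hτ₂
    obtain ⟨hτ, s, hs, hsτ⟩ := Finset.mem_filter.1 hτ₁
    obtain ⟨-, s', hs', hsτ'⟩ := Finset.mem_filter.1 hτ₂
    have := honce τ hτ _ _ (subset_closure hsτ) (subset_closure hsτ')
    linarith [hs.2, hs'.1]
  have hcard : (T.erase σ).card < m := hm ▸ Finset.card_erase_lt_of_mem hσT
  have h₁ := ih T₁.card ((Finset.card_le_card hT₁T).trans_lt hcard) has₁.le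
    (fun s hs => hreg s ⟨hs.1, by linarith [hs.2]⟩) ha hg₁ rfl
  have h₂ := ih T₂.card ((Finset.card_le_card hT₂T).trans_lt hcard) hs₂b.le
    (fun s hs => hreg s ⟨by linarith [hs.1], hs.2⟩) hg₂ hb rfl
  have h₃ := hjump _ hs₂r _ hs₁r hg₂ hg₁
  have hsum : ∑ τ ∈ T₁, J τ + ∑ τ ∈ T₂, J τ + J σ ≤ ∑ τ ∈ T, J τ := by
    rw [← Finset.sum_erase_add T J hσT, ← Finset.sum_union hdisj]
    exact add_le_add_left (Finset.sum_le_sum_of_subset_of_nonneg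
      (Finset.union_subset hT₁T hT₂T) fun τ hτ _ => hJ0 a b τ (Finset.mem_of_mem_erase hτ)) _
  refine le_trans ?_ hsum
  calc |D.stepFun w (x + b • h) - D.stepFun w (x + a • h)|
      = |(D.stepFun w (x + s₁ • h) - D.stepFun w (x + a • h)) +
          (D.stepFun w (x + b • h) - D.stepFun w (x + s₂ • h)) +
          (D.stepFun w (x + s₂ • h) - D.stepFun w (x + s₁ • h))| := by
        congr 1
        ring
    _ ≤ |D.stepFun w (x + s₁ • h) - D.stepFun w (x + a • h)| +
          |D.stepFun w (x + b • h) - D.stepFun w (x + s₂ • h)| +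
          |D.stepFun w (x + s₂ • h) - D.stepFun w (x + s₁ • h)| := abs_add_three _ _ _
    _ ≤ _ := add_le_add (add_le_add h₁ h₂) h₃

/-- A segment can meet a hyperplane twice only if it lies in it, which forces `x` into a null set.
The relative boundaries of edges have surface measure zero, so the points whose segment meets them
are negligible by `volume_sweep_le`. The grid and its translate are null. -/
theorem ae_segment_regular (D : SpaceDiscretisation Ω) (h : EuclideanSpace ℝ (Fin d)) :
    ∀ᵐ x : EuclideanSpace ℝ (Fin d),
      (∀ σ ∈ D.edges, ∀ s t : ℝ, x + s • h ∈ closure σ → x + t • h ∈ closure σ → s = t) ∧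
      (∀ t ∈ Set.Icc (0 : ℝ) 1, ∀ σ ∈ D.edges, x + t • h ∉ closure σ \ σ) ∧
      x + (0 : ℝ) • h ∉ ⋃ σ ∈ D.edges, closure σ ∧
      x + (1 : ℝ) • h ∉ ⋃ σ ∈ D.edges, closure σ := by
  refine Filter.Eventually.and ?_ (Filter.Eventually.and ?_ (Filter.Eventually.and ?_ ?_))
  · rw [Filter.eventually_all_finset]
    intro σ hσ
    obtain ⟨n, a, hn, hspan, -⟩ := D.exists_edge_equation hσ
    have hae : ∀ᵐ x : EuclideanSpace ℝ (Fin d), ⟪n, x⟫ ≠ a := by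
      rw [ae_iff]
      simpa using volume_hyperplane hn a
    filter_upwards [hae] with x hx s t hs ht
    have hs' : x + s • h ∈ {x | ⟪n, x⟫ = a} := hspan ▸ closure_edge_subset hs
    have ht' : x + t • h ∈ {x | ⟪n, x⟫ = a} := hspan ▸ closure_edge_subset ht
    rw [Set.mem_ofPred_eq, inner_add_right, inner_smul_right] at hs' ht'
    have h1 : (s - t) * ⟪n, h⟫ = 0 := by linarith
    rcases mul_eq_zero.1 h1 with h2 | h2
    · exact sub_eq_zero.1 h2
    · rw [h2, mul_zero, add_zero] at hs'
      exact absurd hs' hx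
  · have : ∀ᵐ x : EuclideanSpace ℝ (Fin d), ∀ σ ∈ D.edges,
        ¬ ∃ t ∈ Set.Icc (0 : ℝ) 1, x + t • h ∈ closure σ \ σ := by
      rw [Filter.eventually_all_finset]
      intro σ hσ
      obtain ⟨n, a, hn, hspan, -⟩ := D.exists_edge_equation hσ
      rw [ae_iff]
      simp only [not_not]
      have := volume_sweep_le hn (S := closure σ \ σ) (a := a)
        (isClosed_closure.measurableSet.diff (D.measurableSet_edge hσ))
        (Set.sdiff_subset.trans (hspan ▸ closure_edge_subset)) h
      rw [D.edge_boundary_null σ hσ, mul_zero] at this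
      exact le_antisymm this zero_le
    filter_upwards [this] with x hx t ht σ hσ hmem
    exact hx σ hσ ⟨t, ht, hmem⟩
  · rw [ae_iff]
    simp only [not_not, zero_smul, add_zero]
    exact D.volume_grid
  · rw [ae_iff]
    simp only [not_not, one_smul]
    have := measure_preimage_add_right (volume : Measure (EuclideanSpace ℝ (Fin d))) h
      (⋃ σ ∈ D.edges, closure σ)
    rw [D.volume_grid] at this
    exact this

/-- The translation estimate: piecewise constant functions extended by zero have bounded variation,
bounded by the sum of the jumps weighted by the measures of the edges. -/
theorem BoundsJumps.lintegral_stepFun_translate_le {w J : Set (EuclideanSpace ℝ (Fin d)) → ℝ}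
    (hJ : D.BoundsJumps w J) (hb : Bornology.IsBounded Ω) (h : EuclideanSpace ℝ (Fin d)) :
    ∫⁻ x, ENNReal.ofReal |D.stepFun w (x + h) - D.stepFun w x| ≤
      ENNReal.ofReal (‖h‖ * ∑ σ ∈ D.edges, (surfaceMeasure d).real σ * J σ) := by
  classical
  -- Measurable hulls have the same volume and make it unnecessary to prove the swept sets
  -- measurable.
  set M : Set (EuclideanSpace ℝ (Fin d)) → Set (EuclideanSpace ℝ (Fin d)) := fun σ =>
    toMeasurable volume {x | ∃ t ∈ Set.Icc (0 : ℝ) 1, x + t • h ∈ σ} with hM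
  calc ∫⁻ x, ENNReal.ofReal |D.stepFun w (x + h) - D.stepFun w x|
      ≤ ∫⁻ x, ∑ σ ∈ D.edges, (M σ).indicator (fun _ => ENNReal.ofReal (J σ)) x := by
        refine lintegral_mono_ae ?_
        filter_upwards [D.ae_segment_regular h] with x hx
        have h1 := hJ.abs_stepFun_sub_le hx.1 zero_le_one hx.2.1 hx.2.2.1 hx.2.2.2
        rw [zero_smul, add_zero, one_smul] at h1
        refine (ENNReal.ofReal_le_ofReal h1).trans ?_
        rw [ENNReal.ofReal_sum_of_nonneg fun σ hσ => hJ.nonneg (Finset.mem_filter.1 hσ).1,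
          Finset.sum_filter]
        refine Finset.sum_le_sum fun σ hσ => ?_
        split_ifs with hc
        · obtain ⟨t, ht, htσ⟩ := hc
          rw [Set.indicator_of_mem]
          exact subset_toMeasurable _ _ ⟨t, ⟨ht.1.le, ht.2.le⟩, htσ⟩
        · exact zero_le
    _ = ∑ σ ∈ D.edges, ENNReal.ofReal (J σ) *
          volume {x | ∃ t ∈ Set.Icc (0 : ℝ) 1, x + t • h ∈ σ} := by
        rw [lintegral_finsetSum]
        · refine Finset.sum_congr rfl fun σ _ => ?_
          rw [lintegral_indicator_const (measurableSet_toMeasurable _ _), measure_toMeasurable]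
        · intro σ _
          exact measurable_const.indicator (measurableSet_toMeasurable _ _)
    _ ≤ ∑ σ ∈ D.edges, ENNReal.ofReal (‖h‖ * ((surfaceMeasure d).real σ * J σ)) := by
        refine Finset.sum_le_sum fun σ hσ => ?_
        obtain ⟨n, a, hn, hspan, -⟩ := D.exists_edge_equation hσ
        have h1 := volume_sweep_le hn (D.measurableSet_edge hσ) (hspan ▸ subset_affineSpan ℝ σ) h
        rw [ENNReal.ofReal_mul (norm_nonneg h), ENNReal.ofReal_mul measureReal_nonneg,
          ofReal_measureReal (D.surfaceMeasure_edge_lt_top hb hσ).ne]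
        calc _ ≤ ENNReal.ofReal (J σ) * (ENNReal.ofReal ‖h‖ * surfaceMeasure d σ) := by gcongr
          _ = _ := by ring
    _ = _ := by
        rw [← ENNReal.ofReal_sum_of_nonneg, Finset.mul_sum]
        intro σ hσ
        have := hJ.nonneg hσ
        positivity

end SpaceDiscretisation

/-! ### Kolmogorov compactness in `L¹` -/

theorem TotallyBounded.exists_finite_index_dist_lt {ι X : Type*} [PseudoMetricSpace X] {A : ι → X}
    (hA : TotallyBounded (Set.range A)) {δ : ℝ} (hδ : 0 < δ) :
    ∃ t : Set ι, t.Finite ∧ ∀ i, ∃ j ∈ t, dist (A i) (A j) < δ := by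
  obtain ⟨s, hs, hsf, hcov⟩ := hA.exists_subset (Metric.dist_mem_uniformity hδ)
  rcases isEmpty_or_nonempty ι with h | h
  · exact ⟨∅, Set.finite_empty, fun i => (h.false i).elim⟩
  have hpre : ∀ y ∈ s, ∃ i, A i = y := fun y hy => hs hy
  choose! g hg using hpre
  refine ⟨g '' s, hsf.image g, fun i => ?_⟩
  obtain ⟨y, hy, hiy⟩ := Set.mem_iUnion₂.1 (hcov ⟨i, rfl⟩)
  refine ⟨g y, Set.mem_image_of_mem g hy, ?_⟩
  rw [hg y hy]
  exact hiy

/-- By Tonelli the translation bound is integrated over shifts of length less than `2 * δ`; `2 ^ d`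
is the ratio of the volumes of the two balls. -/
theorem lintegral_ball_translate_le {d : ℕ} {f : EuclideanSpace ℝ (Fin d) → ℝ} (hf : Measurable f)
    {V : ℝ} (hV0 : 0 ≤ V) (hV : ∀ h, ∫⁻ x, ‖f (x + h) - f x‖ₑ ≤ ENNReal.ofReal (‖h‖ * V))
    {δ : ℝ} (hδ : 0 < δ) :
    ∫⁻ x, (volume (Metric.ball (0 : EuclideanSpace ℝ (Fin d)) δ))⁻¹ *
      ∫⁻ h in Metric.ball (0 : EuclideanSpace ℝ (Fin d)) (2 * δ), ‖f (x + h) - f x‖ₑ ≤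
    ENNReal.ofReal (2 ^ d * (2 * δ * V)) := by
  have hB0 : volume (Metric.ball (0 : EuclideanSpace ℝ (Fin d)) δ) ≠ 0 :=
    (Metric.measure_ball_pos _ _ hδ).ne'
  have hBt : volume (Metric.ball (0 : EuclideanSpace ℝ (Fin d)) δ) ≠ ∞ := measure_ball_lt_top.ne
  have hm : Measurable (Function.uncurry fun (x h : EuclideanSpace ℝ (Fin d)) =>
      ‖f (x + h) - f x‖ₑ) := by
    unfold Function.uncurry
    fun_prop
  rw [lintegral_const_mul' _ _ (ENNReal.inv_ne_top.2 hB0), lintegral_lintegral_swap hm.aemeasurable]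
  have h1 : ∫⁻ h in Metric.ball (0 : EuclideanSpace ℝ (Fin d)) (2 * δ),
      ∫⁻ x, ‖f (x + h) - f x‖ₑ ≤
      ∫⁻ _h in Metric.ball (0 : EuclideanSpace ℝ (Fin d)) (2 * δ), ENNReal.ofReal (2 * δ * V) := by
    refine setLIntegral_mono measurable_const fun h hh => (hV h).trans ?_
    have := (mem_ball_zero_iff.1 hh).le
    gcongr
  rw [setLIntegral_const, Measure.addHaar_ball_mul_of_pos _ _ two_pos, finrank_euclideanSpace_fin]
    at h1
  calc _ ≤ (volume (Metric.ball (0 : EuclideanSpace ℝ (Fin d)) δ))⁻¹ *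
        (ENNReal.ofReal (2 * δ * V) * (ENNReal.ofReal (2 ^ d) *
          volume (Metric.ball (0 : EuclideanSpace ℝ (Fin d)) δ))) := by gcongr
    _ = ((volume (Metric.ball (0 : EuclideanSpace ℝ (Fin d)) δ))⁻¹ *
          volume (Metric.ball (0 : EuclideanSpace ℝ (Fin d)) δ)) *
        (ENNReal.ofReal (2 ^ d) * ENNReal.ofReal (2 * δ * V)) := by ring
    _ = _ := by
      rw [ENNReal.inv_mul_cancel hB0 hBt, one_mul, ← ENNReal.ofReal_mul (by positivity)]

/-- Points of a ball of radius `δ` are less than `2 * δ` apart. The bound does not depend on the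
centre `z`, so it can be integrated in `x` without partitioning the domain among the balls. -/
theorem enorm_sub_setAverage_ball_le {d : ℕ} {f : EuclideanSpace ℝ (Fin d) → ℝ}
    (hf : Integrable f) {δ : ℝ} (hδ : 0 < δ) {x z : EuclideanSpace ℝ (Fin d)}
    (hx : x ∈ Metric.ball z δ) :
    ‖f x - ⨍ y in Metric.ball z δ, f y‖ₑ ≤
      (volume (Metric.ball (0 : EuclideanSpace ℝ (Fin d)) δ))⁻¹ *
      ∫⁻ h in Metric.ball (0 : EuclideanSpace ℝ (Fin d)) (2 * δ), ‖f (x + h) - f x‖ₑ := by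
  have hB : volume (Metric.ball z δ) = volume (Metric.ball (0 : EuclideanSpace ℝ (Fin d)) δ) :=
    Measure.addHaar_ball_center _ _ _
  have hB0 : volume (Metric.ball z δ) ≠ 0 := (Metric.measure_ball_pos _ _ hδ).ne'
  have hBt : volume (Metric.ball z δ) ≠ ∞ := measure_ball_lt_top.ne
  have : IsFiniteMeasure (volume.restrict (Metric.ball z δ)) := ⟨by simpa using hBt.lt_top⟩
  have h1 : f x - ⨍ y in Metric.ball z δ, f y =
      (volume.real (Metric.ball z δ))⁻¹ * ∫ y in Metric.ball z δ, (f x - f y) := by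
    have hr : volume.real (Metric.ball z δ) ≠ 0 := by
      simp [measureReal_def, ENNReal.toReal_eq_zero_iff, hB0, hBt]
    rw [integral_sub (integrable_const _) hf.integrableOn, setAverage_eq, setIntegral_const,
      smul_eq_mul, smul_eq_mul, mul_sub, inv_mul_cancel_left₀ hr]
  rw [h1, enorm_mul, ← hB]
  gcongr
  · rw [Real.enorm_eq_ofReal (by positivity), ENNReal.ofReal_inv_of_pos, ofReal_measureReal hBt]
    exact ENNReal.toReal_pos hB0 hBt
  · refine (enorm_integral_le_lintegral_enorm _).trans ?_
    have h2 := lintegral_add_left_eq_self (μ := volume)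
      ((Metric.ball x (2 * δ)).indicator fun y => ‖f y - f x‖ₑ) x
    calc ∫⁻ y in Metric.ball z δ, ‖f x - f y‖ₑ
        ≤ ∫⁻ y in Metric.ball x (2 * δ), ‖f y - f x‖ₑ := by
          simp_rw [enorm_sub_rev (f x)]
          refine lintegral_mono_set fun y hy => ?_
          rw [Metric.mem_ball] at *
          linarith [dist_triangle_right y x z]
      _ = _ := by
          rw [← lintegral_indicator measurableSet_ball, ← lintegral_indicator measurableSet_ball,
            ← h2]
          refine lintegral_congr fun h => ?_
          simp only [Set.indicator, Metric.mem_ball, dist_self_add_left, dist_zero_right]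

/-- A form of Kolmogorov's compactness criterion in `L¹`: a family with a uniform bound in `L¹` and
a uniform modulus of continuity of the translations is totally bounded in `L¹` of bounded sets. -/
theorem exists_finite_net_of_translate_le {d : ℕ} {ι : Type*}
    {f : ι → EuclideanSpace ℝ (Fin d) → ℝ} (hf : ∀ i, Measurable (f i)) {I V : ℝ}
    (hI : ∀ i, ∫⁻ x, ‖f i x‖ₑ ≤ ENNReal.ofReal I) (hV0 : 0 ≤ V)
    (hV : ∀ i h, ∫⁻ x, ‖f i (x + h) - f i x‖ₑ ≤ ENNReal.ofReal (‖h‖ * V))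
    {S : Set (EuclideanSpace ℝ (Fin d))} (hS : Bornology.IsBounded S) {ε : ℝ} (hε : 0 < ε) :
    ∃ t : Set ι, t.Finite ∧ ∀ i, ∃ j ∈ t, ∫⁻ x in S, ‖f i x - f j x‖ₑ ≤ ENNReal.ofReal ε := by
  have hint : ∀ i, Integrable (f i) := fun i =>
    ⟨(hf i).aestronglyMeasurable, (hI i).trans_lt ENNReal.ofReal_lt_top⟩
  have hvS := measureReal_nonneg (μ := (volume : Measure (EuclideanSpace ℝ (Fin d)))) (s := S)
  -- The two outer terms pay for replacing `f i` and `f j` by their local averages, the middle one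
  -- for averages that differ by less than `δ` on `S`.
  obtain ⟨δ, hδ, hδε⟩ : ∃ δ > 0, 2 ^ d * (2 * δ * V) + δ * volume.real S +
      2 ^ d * (2 * δ * V) ≤ ε := by
    have hpos : 0 < 4 * 2 ^ d * V + volume.real S + 1 := by positivity
    refine ⟨ε / (4 * 2 ^ d * V + volume.real S + 1), by positivity, ?_⟩
    calc _ = ε / (4 * 2 ^ d * V + volume.real S + 1) * (4 * 2 ^ d * V + volume.real S) := by ring
      _ ≤ ε / (4 * 2 ^ d * V + volume.real S + 1) * (4 * 2 ^ d * V + volume.real S + 1) := by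
          exact mul_le_mul_of_nonneg_left (by linarith) (by positivity)
      _ = ε := div_mul_cancel₀ _ hpos.ne'
  obtain ⟨Z, hZ, hSZ⟩ := Metric.totallyBounded_iff.1
    (hS.isCompact_closure.totallyBounded.subset subset_closure) δ hδ
  have : Fintype Z := hZ.fintype
  let A : ι → Z → ℝ := fun i z => ⨍ y in Metric.ball (z : EuclideanSpace ℝ (Fin d)) δ, f i y
  -- The averages over finitely many balls form a bounded family in a finite-dimensional space.
  have hA : TotallyBounded (Set.range A) := by
    set c := (volume.real (Metric.ball (0 : EuclideanSpace ℝ (Fin d)) δ))⁻¹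
    have hc : 0 ≤ c := by positivity
    refine (isCompact_closedBall (0 : Z → ℝ) (c * |I|)).totallyBounded.subset ?_
    rintro _ ⟨i, rfl⟩
    rw [mem_closedBall_zero_iff, pi_norm_le_iff_of_nonneg (by positivity)]
    intro z
    have h1 : volume.real (Metric.ball (z : EuclideanSpace ℝ (Fin d)) δ) =
        volume.real (Metric.ball (0 : EuclideanSpace ℝ (Fin d)) δ) := by
      rw [measureReal_def, Measure.addHaar_ball_center, measureReal_def]
    have h2 : ∫ x, ‖f i x‖ ≤ |I| := by
      rw [integral_norm_eq_lintegral_enorm (hint i).1]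
      refine ENNReal.toReal_le_of_le_ofReal (abs_nonneg I) ((hI i).trans ?_)
      exact ENNReal.ofReal_le_ofReal (le_abs_self I)
    simp only [A]
    rw [setAverage_eq, norm_smul, h1, Real.norm_of_nonneg hc]
    gcongr
    refine (norm_integral_le_integral_norm _).trans (le_trans ?_ h2)
    exact setIntegral_le_integral (hint i).norm (Filter.Eventually.of_forall fun _ => norm_nonneg _)
  obtain ⟨t, ht, htA⟩ := hA.exists_finite_index_dist_lt hδ
  refine ⟨t, ht, fun i => ?_⟩
  obtain ⟨j, hj, hij⟩ := htA i
  refine ⟨j, hj, ?_⟩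
  let M : ι → EuclideanSpace ℝ (Fin d) → ℝ≥0∞ := fun i x =>
    (volume (Metric.ball (0 : EuclideanSpace ℝ (Fin d)) δ))⁻¹ *
      ∫⁻ h in Metric.ball (0 : EuclideanSpace ℝ (Fin d)) (2 * δ), ‖f i (x + h) - f i x‖ₑ
  have hMm : ∀ i, Measurable (M i) := by
    intro i
    have hm : Measurable (Function.uncurry fun (x h : EuclideanSpace ℝ (Fin d)) =>
        ‖f i (x + h) - f i x‖ₑ) := by
      unfold Function.uncurry
      have := hf i
      fun_prop
    exact hm.lintegral_prod_right'.const_mul _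
  have hpt : ∀ x ∈ S, ‖f i x - f j x‖ₑ ≤ M i x + ENNReal.ofReal δ + M j x := by
    intro x hx
    obtain ⟨z, hz, hxz⟩ := Set.mem_iUnion₂.1 (hSZ hx)
    have hi := enorm_sub_setAverage_ball_le (hint i) hδ hxz
    have hj := enorm_sub_setAverage_ball_le (hint j) hδ hxz
    have hd : ‖A i ⟨z, hz⟩ - A j ⟨z, hz⟩‖ₑ ≤ ENNReal.ofReal δ := by
      rw [Real.enorm_eq_ofReal_abs]
      refine ENNReal.ofReal_le_ofReal ?_
      rw [← Real.dist_eq]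
      exact (dist_le_pi_dist _ _ _).trans hij.le
    rw [enorm_sub_rev] at hj
    calc ‖f i x - f j x‖ₑ = ‖(f i x - A i ⟨z, hz⟩) + (A i ⟨z, hz⟩ - A j ⟨z, hz⟩) +
          (A j ⟨z, hz⟩ - f j x)‖ₑ := by
          congr 1
          ring
      _ ≤ ‖f i x - A i ⟨z, hz⟩‖ₑ + ‖A i ⟨z, hz⟩ - A j ⟨z, hz⟩‖ₑ +
          ‖A j ⟨z, hz⟩ - f j x‖ₑ :=
          (enorm_add_le _ _).trans (by gcongr; exact enorm_add_le _ _)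
      _ ≤ _ := by gcongr
  have hM : ∀ i, ∫⁻ x in S, M i x ≤ ENNReal.ofReal (2 ^ d * (2 * δ * V)) := fun i =>
    (setLIntegral_le_lintegral S _).trans (lintegral_ball_translate_le (hf i) hV0 (hV i) hδ)
  have hSt : volume S ≠ ∞ := hS.measure_lt_top.ne
  calc ∫⁻ x in S, ‖f i x - f j x‖ₑ ≤ ∫⁻ x in S, (M i x + ENNReal.ofReal δ + M j x) :=
        setLIntegral_mono (((hMm i).add measurable_const).add (hMm j)) hpt
    _ = (∫⁻ x in S, M i x) + ENNReal.ofReal δ * volume S + ∫⁻ x in S, M j x := by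
        rw [lintegral_add_right _ (hMm j), lintegral_add_left (hMm i), setLIntegral_const]
    _ ≤ ENNReal.ofReal (2 ^ d * (2 * δ * V)) + ENNReal.ofReal (δ * volume.real S) +
          ENNReal.ofReal (2 ^ d * (2 * δ * V)) := by
        rw [ENNReal.ofReal_mul hδ.le, ofReal_measureReal hSt]
        gcongr
        · exact hM i
        · exact hM j
    _ = ENNReal.ofReal (2 ^ d * (2 * δ * V) + δ * volume.real S + 2 ^ d * (2 * δ * V)) := by
        rw [ENNReal.ofReal_add, ENNReal.ofReal_add] <;> positivity
    _ ≤ ENNReal.ofReal ε := ENNReal.ofReal_le_ofReal hδε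

/-! ### Inequalities for signed powers -/

/-- The odd extension of `t ↦ t ^ p`. -/
noncomputable def signedPow (p t : ℝ) : ℝ := t * |t| ^ (p - 1)

theorem mul_rpow_sub_one_self {p x : ℝ} (hp : 1 ≤ p) (hx : 0 ≤ x) : x * x ^ (p - 1) = x ^ p := by
  rcases hx.eq_or_lt with rfl | hx
  · rw [zero_mul, Real.zero_rpow (by linarith)]
  · rw [← Real.rpow_one_add' hx.le (by linarith), add_sub_cancel]

theorem signedPow_zero (p : ℝ) : signedPow p 0 = 0 := by simp [signedPow]

theorem signedPow_neg (p t : ℝ) : signedPow p (-t) = -signedPow p t := by simp [signedPow]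

theorem abs_signedPow {p : ℝ} (hp : 1 ≤ p) (t : ℝ) : |signedPow p t| = |t| ^ p := by
  rw [signedPow, abs_mul, abs_of_nonneg (Real.rpow_nonneg (abs_nonneg t) _),
    mul_rpow_sub_one_self hp (abs_nonneg t)]

theorem rpow_sub_rpow_le {p x y : ℝ} (hp : 1 ≤ p) (hy : 0 ≤ y) (hyx : y ≤ x) :
    x ^ p - y ^ p ≤ p * x ^ (p - 1) * (x - y) := by
  rcases (hy.trans hyx).eq_or_lt with rfl | hx
  · have : y = 0 := le_antisymm hyx hy
    simp [this]
  -- Bernoulli's inequality for the ratio `y / x`, then multiplied by `x ^ p`.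
  have h := one_add_mul_self_le_rpow_one_add (s := y / x - 1)
    (by have : 0 ≤ y / x := by positivity
        linarith) hp
  rw [add_sub_cancel, Real.div_rpow hy hx.le, le_div_iff₀ (by positivity)] at h
  have h2 : (1 + p * (y / x - 1)) * x ^ p = x ^ p - p * x ^ (p - 1) * (x - y) := by
    rw [← mul_rpow_sub_one_self hp hx.le]
    field_simp
    ring
  linarith

/-- A mean value bound. Its sum over both endpoints makes the jump bound split between the two cells
of an edge. -/
theorem abs_signedPow_sub_le {p : ℝ} (hp : 1 ≤ p) (a b : ℝ) :
    |signedPow p a - signedPow p b| ≤ p * (|a| ^ (p - 1) + |b| ^ (p - 1)) * |a - b| := by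
  wlog hba : |b| ≤ |a| generalizing a b
  · rw [abs_sub_comm, add_comm (|a| ^ _), abs_sub_comm a]
    exact this b a (le_of_not_ge hba)
  have h1 : signedPow p a - signedPow p b =
      |a| ^ (p - 1) * (a - b) + b * (|a| ^ (p - 1) - |b| ^ (p - 1)) := by
    rw [signedPow, signedPow]
    ring
  have hmono : |b| ^ (p - 1) ≤ |a| ^ (p - 1) :=
    Real.rpow_le_rpow (abs_nonneg b) hba (by linarith)
  have ha0 : 0 ≤ |a| ^ (p - 1) := by positivity
  have h2 : |b| * (|a| ^ (p - 1) - |b| ^ (p - 1)) ≤ (p - 1) * |a| ^ (p - 1) * |a - b| := by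
    have h3 := rpow_sub_rpow_le hp (abs_nonneg b) hba
    have h4 := mul_rpow_sub_one_self hp (abs_nonneg b)
    have h5 := mul_rpow_sub_one_self hp (abs_nonneg a)
    have h6 := abs_sub_abs_le_abs_sub a b
    calc |b| * (|a| ^ (p - 1) - |b| ^ (p - 1)) ≤ (p - 1) * |a| ^ (p - 1) * (|a| - |b|) := by
          linarith
      _ ≤ _ := by
          have : 0 ≤ p - 1 := by linarith
          gcongr
  rw [h1]
  refine (abs_add_le _ _).trans ?_
  rw [abs_mul, abs_mul, abs_of_nonneg ha0, abs_of_nonneg (sub_nonneg.2 hmono)]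
  have h7 : 0 ≤ p * |b| ^ (p - 1) * |a - b| := by positivity
  linarith

/-- The inverse of the signed power is Hölder continuous of exponent `1 / p`. By symmetry `|b| ≤ a`,
so that `a - b ≤ 2 * a`; it remains to compare `a ^ (p - 1) * (a - b)` with the difference of signed
powers, according to the sign of `b`. -/
theorem abs_sub_rpow_le_signedPow {p : ℝ} (hp : 1 ≤ p) (a b : ℝ) :
    |a - b| ^ p ≤ 2 ^ p * |signedPow p a - signedPow p b| := by
  wlog hba : |b| ≤ |a| generalizing a b
  · rw [abs_sub_comm, abs_sub_comm (signedPow p a)]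
    exact this b a (le_of_not_ge hba)
  wlog ha : 0 ≤ a generalizing a b
  · have := this (-a) (-b) (by simpa using hba) (by linarith)
    rw [signedPow_neg, signedPow_neg, neg_sub_neg, neg_sub_neg, abs_sub_comm,
      abs_sub_comm (signedPow p b)] at this
    exact this
  rw [abs_of_nonneg ha] at hba
  have hb := abs_le.1 hba
  have hq : 0 ≤ p - 1 := by linarith
  have haq : 0 ≤ a ^ (p - 1) := by positivity
  have hmono : |b| ^ (p - 1) ≤ a ^ (p - 1) := Real.rpow_le_rpow (abs_nonneg b) hba hq
  have hbq : 0 ≤ |b| ^ (p - 1) := by positivity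
  have hlow : a ^ (p - 1) * (a - b) ≤ 2 * (signedPow p a - signedPow p b) := by
    rw [signedPow, signedPow, abs_of_nonneg ha]
    rcases le_total 0 b with h | h
    · nlinarith [mul_le_mul_of_nonneg_left hmono h, mul_nonneg haq (sub_nonneg.2 hb.2)]
    · nlinarith [mul_nonneg haq (by linarith : 0 ≤ a + b), mul_nonneg hbq (neg_nonneg.2 h)]
  have hab : 0 ≤ a - b := by linarith
  rw [abs_of_nonneg hab, ← mul_rpow_sub_one_self hp hab, ← mul_rpow_sub_one_self hp zero_le_two]
  calc (a - b) * (a - b) ^ (p - 1) ≤ (a - b) * (2 * a) ^ (p - 1) := by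
        gcongr
        linarith
    _ = 2 ^ (p - 1) * (a ^ (p - 1) * (a - b)) := by
        rw [Real.mul_rpow zero_le_two ha]
        ring
    _ ≤ 2 ^ (p - 1) * (2 * (signedPow p a - signedPow p b)) := by gcongr
    _ ≤ 2 ^ (p - 1) * (2 * |signedPow p a - signedPow p b|) := by
        gcongr
        exact le_abs_self _
    _ = _ := by ring

/-- A form of Young's inequality obtained by comparing `a` with `ε * b`. It needs no conjugate
exponent, so `p = 1` is included. -/
theorem mul_rpow_sub_one_le {p a b ε : ℝ} (hp : 1 ≤ p) (ha : 0 ≤ a) (hb : 0 ≤ b) (hε : 0 < ε) :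
    a * b ^ (p - 1) ≤ ε * b ^ p + ε ^ (1 - p) * a ^ p := by
  have hq : 0 ≤ p - 1 := by linarith
  rcases le_total a (ε * b) with h | h
  · calc a * b ^ (p - 1) ≤ ε * b * b ^ (p - 1) := by gcongr
      _ = ε * b ^ p := by rw [mul_assoc, mul_rpow_sub_one_self hp hb]
      _ ≤ _ := le_add_of_nonneg_right (by positivity)
  · have h1 : b ≤ ε⁻¹ * a := by
      rw [inv_mul_eq_div, le_div_iff₀ hε]
      linarith
    calc a * b ^ (p - 1) ≤ a * (ε⁻¹ * a) ^ (p - 1) := by gcongr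
      _ = ε ^ (1 - p) * a ^ p := by
        rw [Real.mul_rpow (by positivity) ha, Real.inv_rpow hε.le, ← Real.rpow_neg hε.le, neg_sub,
          ← mul_rpow_sub_one_self hp ha]
        ring
      _ ≤ _ := le_add_of_nonneg_left (by positivity)

theorem isCompact_closure_range_toLp {ι α : Type*} [MeasurableSpace α] {μ : Measure α} {p : ℝ≥0∞}
    [Fact (1 ≤ p)] {f : ι → α → ℝ} (hf : ∀ i, MemLp (f i) p μ)
    (hnet : ∀ δ : ℝ, 0 < δ → ∃ t : Set ι, t.Finite ∧
      ∀ i, ∃ j ∈ t, eLpNorm (f i - f j) p μ ≤ ENNReal.ofReal δ) :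
    IsCompact (closure (Set.range fun i => (hf i).toLp (f i))) := by
  refine TotallyBounded.isCompact_of_isClosed (TotallyBounded.closure ?_) isClosed_closure
  rw [Metric.totallyBounded_iff]
  intro ε hε
  obtain ⟨t, ht, hcov⟩ := hnet (ε / 2) (half_pos hε)
  refine ⟨(fun i => (hf i).toLp (f i)) '' t, ht.image _, ?_⟩
  rintro _ ⟨i, rfl⟩
  obtain ⟨j, hj, hij⟩ := hcov i
  refine Set.mem_biUnion (Set.mem_image_of_mem _ hj) ?_
  rw [Metric.mem_ball, dist_edist, Lp.edist_toLp_toLp]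
  exact (ENNReal.toReal_le_of_le_ofReal (half_pos hε).le hij).trans_lt (half_lt_self hε)

/-! ### Uniform bounds from the discrete norm -/

namespace SpaceDiscretisation

variable {d : ℕ} {Ω : Set (EuclideanSpace ℝ (Fin d))} {D : SpaceDiscretisation Ω}

theorem cellsOf_eq_singleton_or_pair {K σ : Set (EuclideanSpace ℝ (Fin d))} (hσ : σ ∈ D.edges)
    (hK : K ∈ D.cellsOf σ) :
    D.cellsOf σ = {K} ∨ ∃ L, L ≠ K ∧ D.cellsOf σ = {K, L} := by
  classical
  have hset : {K | K ∈ D.cells ∧ σ ∈ D.edgesOf K} = (D.cellsOf σ : Set _) := by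
    ext L
    exact D.mem_cellsOf.symm
  have h := D.edge_cells σ hσ
  rw [hset, Set.ncard_coe_finset] at h
  rcases h with ⟨h, -⟩ | h
  · obtain ⟨L, hL⟩ := Finset.card_eq_one.1 h
    rw [hL, Finset.mem_singleton] at hK
    exact Or.inl (hK ▸ hL)
  · right
    have h1 : ((D.cellsOf σ).erase K).card = 1 := by rw [Finset.card_erase_of_mem hK, h]
    obtain ⟨L, hL⟩ := Finset.card_eq_one.1 h1
    have hLm : L ∈ (D.cellsOf σ).erase K := hL ▸ Finset.mem_singleton_self L
    refine ⟨L, Finset.ne_of_mem_erase hLm, ?_⟩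
    rw [← Finset.insert_erase hK, hL]

theorem stepFun_of_notMem (w : Set (EuclideanSpace ℝ (Fin d)) → ℝ) {x : EuclideanSpace ℝ (Fin d)}
    (hx : ∀ K ∈ D.cells, x ∉ K) : D.stepFun w x = 0 :=
  Finset.sum_eq_zero fun K hK => Set.indicator_of_notMem (hx K hK) _

theorem stepFun_of_notMem_domain (w : Set (EuclideanSpace ℝ (Fin d)) → ℝ)
    {x : EuclideanSpace ℝ (Fin d)} (hx : x ∉ Ω) : D.stepFun w x = 0 :=
  stepFun_of_notMem w fun K hK hxK => hx (D.cell_subset K hK hxK)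

theorem stepFun_comp {g : ℝ → ℝ} (hg : g 0 = 0) (w : Set (EuclideanSpace ℝ (Fin d)) → ℝ)
    (x : EuclideanSpace ℝ (Fin d)) : D.stepFun (fun K => g (w K)) x = g (D.stepFun w x) := by
  by_cases h : ∃ K ∈ D.cells, x ∈ K
  · obtain ⟨K, hK, hx⟩ := h
    rw [stepFun_of_mem _ hK hx, stepFun_of_mem _ hK hx]
  · push Not at h
    rw [stepFun_of_notMem _ h, stepFun_of_notMem _ h, hg]

theorem measurable_stepFun (D : SpaceDiscretisation Ω)
    (w : Set (EuclideanSpace ℝ (Fin d)) → ℝ) : Measurable (D.stepFun w) :=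
  Finset.measurable_fun_sum _ fun K hK =>
    measurable_const.indicator (D.cell_isOpen K hK).measurableSet

theorem memLp_stepFun (D : SpaceDiscretisation Ω) (hb : Bornology.IsBounded Ω)
    (w : Set (EuclideanSpace ℝ (Fin d)) → ℝ) (p : ℝ≥0∞) : MemLp (D.stepFun w) p :=
  memLp_finsetSum _ fun K hK => memLp_indicator_const p (D.cell_isOpen K hK).measurableSet _
    (Or.inr (D.volume_cell_lt_top hb hK).ne)

theorem lintegral_enorm_stepFun (D : SpaceDiscretisation Ω) (hb : Bornology.IsBounded Ω)
    (w : Set (EuclideanSpace ℝ (Fin d)) → ℝ) :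
    ∫⁻ x, ‖D.stepFun w x‖ₑ = ENNReal.ofReal (∑ K ∈ D.cells, volume.real K * |w K|) := by
  have h1 : ∀ x, ‖D.stepFun w x‖ₑ = ENNReal.ofReal (D.stepFun (fun K => |w K|) x) := fun x => by
    rw [stepFun_comp abs_zero, Real.enorm_eq_ofReal_abs]
  have h0 : ∀ K ∈ D.cells, Integrable (K.indicator fun _ => |w K|) := fun K hK =>
    (integrable_indicator_iff (D.cell_isOpen K hK).measurableSet).2
      (integrableOn_const (D.volume_cell_lt_top hb hK).ne)
  have h2 : Integrable (D.stepFun fun K => |w K|) := integrable_finsetSum _ h0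
  simp_rw [h1]
  rw [← ofReal_integral_eq_lintegral_ofReal h2]
  · congr 1
    simp only [stepFun]
    rw [integral_finsetSum _ h0]
    refine Finset.sum_congr rfl fun K hK => ?_
    rw [integral_indicator_const _ (D.cell_isOpen K hK).measurableSet, smul_eq_mul]
  · exact Filter.Eventually.of_forall fun x => Finset.sum_nonneg fun K _ =>
      Set.indicator_nonneg (fun _ _ => abs_nonneg _) x

/-- The closed cells cover `Ω`, and their frontiers lie in the null grid. -/
theorem PiecewiseConstant.indicator_ae_eq {u : EuclideanSpace ℝ (Fin d) → ℝ}
    (hu : D.PiecewiseConstant u) : Ω.indicator u =ᵐ[volume] D.stepFun (D.cellValue u) := by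
  have hae : ∀ᵐ x : EuclideanSpace ℝ (Fin d), x ∉ ⋃ σ ∈ D.edges, closure σ := by
    rw [ae_iff]
    simp only [not_not]
    exact D.volume_grid
  filter_upwards [hae] with x hx
  by_cases hxΩ : x ∈ Ω
  · have hcl := subset_closure hxΩ
    rw [D.closure_eq] at hcl
    obtain ⟨K, hK, hxK⟩ := Set.mem_iUnion₂.1 hcl
    have hxK' : x ∈ K := by
      by_contra hn
      refine hx (D.frontier_subset hK ?_)
      rw [(D.cell_isOpen K hK).frontier_eq]
      exact ⟨hxK, hn⟩
    rw [Set.indicator_of_mem hxΩ, stepFun_of_mem _ hK hxK', cellValue]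
    obtain ⟨c, hc⟩ := hu K hK
    rw [hc x hxK', hc _ (D.point_mem K hK)]
  · rw [Set.indicator_of_notMem hxΩ, stepFun_of_notMem_domain _ hxΩ]

/-- A bound for the jumps across the edges of `signedPow p u`. -/
noncomputable def powJump (D : SpaceDiscretisation Ω) (p : ℝ) (u : EuclideanSpace ℝ (Fin d) → ℝ)
    (σ : Set (EuclideanSpace ℝ (Fin d))) : ℝ :=
  ∑ K ∈ D.cellsOf σ, p * (|D.cellValue u K| ^ (p - 1) * D.jump u K σ)

theorem boundsJumps_signedPow (D : SpaceDiscretisation Ω) {p : ℝ} (hp : 1 ≤ p)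
    (u : EuclideanSpace ℝ (Fin d) → ℝ) :
    D.BoundsJumps (fun K => signedPow p (D.cellValue u K)) (D.powJump p u) := by
  classical
  intro σ hσ K hK
  rcases cellsOf_eq_singleton_or_pair hσ hK with h | ⟨L, hne, h⟩
  · have hj := D.jump_boundary u h
    rw [powJump, h, Finset.sum_singleton, Finset.erase_singleton, Finset.sum_empty, sub_zero,
      abs_signedPow hp, hj, ← mul_rpow_sub_one_self hp (abs_nonneg _), mul_comm (|_| ^ _)]
    exact le_mul_of_one_le_left (by positivity) hp
  · have h' : D.cellsOf σ = {L, K} := by rw [h, Finset.pair_comm]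
    have hj := D.jump_interior u hne.symm h
    have hj' := D.jump_interior u hne h'
    have he : ({K, L} : Finset (Set (EuclideanSpace ℝ (Fin d)))).erase K = {L} :=
      Finset.erase_insert (by simpa using hne.symm)
    rw [powJump, h, Finset.sum_pair hne.symm, he, Finset.sum_singleton, hj, hj',
      abs_sub_comm (D.cellValue u L)]
    refine (abs_signedPow_sub_le hp _ _).trans (le_of_eq ?_)
    ring

theorem dist_pos' {K σ : Set (EuclideanSpace ℝ (Fin d))} (hK : K ∈ D.cellsOf σ) :
    0 < D.dist K σ :=
  D.dist_pos K (D.mem_cellsOf.1 hK).1 σ (D.mem_cellsOf.1 hK).2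

theorem edgeDist_pos {K σ : Set (EuclideanSpace ℝ (Fin d))} (hK : K ∈ D.cellsOf σ) :
    0 < D.edgeDist σ :=
  Finset.sum_pos (fun _ hL => dist_pos' hL) ⟨K, hK⟩

/-- This is how the ratio bound acts: the weight `|σ| d_σ` is replaced by `|σ| d_{K,σ}`, which is
the weight of the discrete norm and is controlled by the volume of `K`. -/
theorem RatioBound.edgeDist_le {η : ℝ} (hη : 0 < η) (hD : D.RatioBound η)
    {K σ : Set (EuclideanSpace ℝ (Fin d))} (hσ : σ ∈ D.edges) (hK : K ∈ D.cellsOf σ) :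
    D.edgeDist σ ≤ (1 + 1 / η) * D.dist K σ := by
  classical
  have hKpos := dist_pos' hK
  rcases cellsOf_eq_singleton_or_pair hσ hK with h | ⟨L, hne, h⟩
  · rw [edgeDist, h, Finset.sum_singleton]
    have : 0 ≤ 1 / η * D.dist K σ := by positivity
    linarith
  · have hL : L ∈ D.cellsOf σ := by simp [h]
    have hr := (hD σ hσ L hL K hK hne).2
    rw [div_le_iff₀ hKpos] at hr
    rw [edgeDist, h, Finset.sum_pair hne.symm]
    linarith

theorem jump_nonneg (u : EuclideanSpace ℝ (Fin d) → ℝ) (K σ : Set (EuclideanSpace ℝ (Fin d))) :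
    0 ≤ D.jump u K σ := abs_nonneg _

theorem sum_energy_le {p C : ℝ} (hp : 1 ≤ p) {u : EuclideanSpace ℝ (Fin d) → ℝ}
    (hC : D.discreteNorm p u ≤ C) :
    ∑ K ∈ D.cells, ∑ σ ∈ D.edgesOf K,
      (surfaceMeasure d).real σ * D.dist K σ * (D.jump u K σ / D.edgeDist σ) ^ p ≤ |C| ^ p := by
  have h0 : 0 ≤ ∑ K ∈ D.cells, ∑ σ ∈ D.edgesOf K,
      (surfaceMeasure d).real σ * D.dist K σ * (D.jump u K σ / D.edgeDist σ) ^ p := by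
    refine Finset.sum_nonneg fun K hK => Finset.sum_nonneg fun σ hσ => ?_
    have hKσ := D.mem_cellsOf.2 ⟨hK, hσ⟩
    have h1 := dist_pos' hKσ
    have h2 := edgeDist_pos hKσ
    have h3 := jump_nonneg (D := D) u K σ
    positivity
  rw [discreteNorm] at hC
  calc _ = ((∑ K ∈ D.cells, ∑ σ ∈ D.edgesOf K, (surfaceMeasure d).real σ * D.dist K σ *
        (D.jump u K σ / D.edgeDist σ) ^ p) ^ (1 / p)) ^ p := by
        rw [← Real.rpow_mul h0, one_div_mul_cancel (by linarith), Real.rpow_one]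
    _ ≤ |C| ^ p := Real.rpow_le_rpow (by positivity) (hC.trans (le_abs_self C)) (by linarith)

/-- The jump is written as `d_σ` times the difference quotient, and Young's inequality separates the
quotient from `|u_K|^(p-1)`. The powers of `u_K` are summed by the cone estimate, those of the
quotients by the discrete norm. -/
theorem sum_powJump_le (hd : 1 ≤ d) (hb : Bornology.IsBounded Ω) {p C η ε : ℝ} (hp : 1 ≤ p)
    (hη : 0 < η) (hε : 0 < ε) (hD : D.RatioBound η) {u : EuclideanSpace ℝ (Fin d) → ℝ}
    (hC : D.discreteNorm p u ≤ C) :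
    ∑ σ ∈ D.edges, (surfaceMeasure d).real σ * D.powJump p u σ ≤
      p * (1 + 1 / η) * (ε * (2 ^ d * ∑ K ∈ D.cells, volume.real K * |D.cellValue u K| ^ p) +
        ε ^ (1 - p) * |C| ^ p) := by
  have hterm : ∀ K ∈ D.cells, ∀ σ ∈ D.edgesOf K, (surfaceMeasure d).real σ *
      (p * (|D.cellValue u K| ^ (p - 1) * D.jump u K σ)) ≤
      p * (1 + 1 / η) * (ε * ((surfaceMeasure d).real σ * D.dist K σ * |D.cellValue u K| ^ p) +
        ε ^ (1 - p) * ((surfaceMeasure d).real σ * D.dist K σ *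
          (D.jump u K σ / D.edgeDist σ) ^ p)) := by
    intro K hK σ hσ
    have hKσ := D.mem_cellsOf.2 ⟨hK, hσ⟩
    have h1 := dist_pos' hKσ
    have h2 := edgeDist_pos hKσ
    have h3 := jump_nonneg (D := D) u K σ
    have h4 := hD.edgeDist_le hη (D.edgesOf_subset K hK hσ) hKσ
    have h5 := mul_rpow_sub_one_le hp (div_nonneg h3 h2.le) (abs_nonneg (D.cellValue u K)) hε
    calc (surfaceMeasure d).real σ * (p * (|D.cellValue u K| ^ (p - 1) * D.jump u K σ))
        = p * (surfaceMeasure d).real σ * D.edgeDist σ *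
          (D.jump u K σ / D.edgeDist σ * |D.cellValue u K| ^ (p - 1)) := by
          field_simp
      _ ≤ p * (surfaceMeasure d).real σ * ((1 + 1 / η) * D.dist K σ) *
          (ε * |D.cellValue u K| ^ p + ε ^ (1 - p) * (D.jump u K σ / D.edgeDist σ) ^ p) := by
          gcongr
      _ = _ := by ring
  calc ∑ σ ∈ D.edges, (surfaceMeasure d).real σ * D.powJump p u σ
      = ∑ K ∈ D.cells, ∑ σ ∈ D.edgesOf K, (surfaceMeasure d).real σ *
          (p * (|D.cellValue u K| ^ (p - 1) * D.jump u K σ)) := by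
        simp_rw [powJump, Finset.mul_sum]
        refine Finset.sum_comm' fun σ K => ?_
        rw [D.mem_cellsOf]
        exact ⟨fun h => ⟨h.2.2, h.2.1⟩, fun h => ⟨D.edgesOf_subset K h.2 h.1, h.2, h.1⟩⟩
    _ ≤ ∑ K ∈ D.cells, ∑ σ ∈ D.edgesOf K, p * (1 + 1 / η) *
          (ε * ((surfaceMeasure d).real σ * D.dist K σ * |D.cellValue u K| ^ p) +
          ε ^ (1 - p) * ((surfaceMeasure d).real σ * D.dist K σ *
          (D.jump u K σ / D.edgeDist σ) ^ p)) :=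
        Finset.sum_le_sum fun K hK => Finset.sum_le_sum fun σ hσ => hterm K hK σ hσ
    _ = p * (1 + 1 / η) * (ε * (∑ K ∈ D.cells, ∑ σ ∈ D.edgesOf K,
          (surfaceMeasure d).real σ * D.dist K σ * |D.cellValue u K| ^ p) +
          ε ^ (1 - p) * ∑ K ∈ D.cells, ∑ σ ∈ D.edgesOf K,
          (surfaceMeasure d).real σ * D.dist K σ * (D.jump u K σ / D.edgeDist σ) ^ p) := by
        simp_rw [← Finset.mul_sum, Finset.sum_add_distrib, ← Finset.mul_sum]
    _ ≤ _ := by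
        gcongr
        · rw [Finset.mul_sum]
          refine Finset.sum_le_sum fun K hK => ?_
          rw [← Finset.sum_mul, ← mul_assoc]
          gcongr
          exact D.sum_surfaceMeasure_mul_dist_le hd hb hK
        · exact sum_energy_le hp hC

/-- A Poincaré inequality: a translation of length `2 * R` moves `Ω` off itself, so on `Ω` the
increment of the step function is minus its value. -/
theorem BoundsJumps.sum_volume_mul_abs_le {w J : Set (EuclideanSpace ℝ (Fin d)) → ℝ}
    (hd : 1 ≤ d) (hJ : D.BoundsJumps w J) {R : ℝ} (hR : 0 ≤ R) (hΩ : Ω ⊆ Metric.ball 0 R) :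
    ∑ K ∈ D.cells, volume.real K * |w K| ≤
      2 * R * ∑ σ ∈ D.edges, (surfaceMeasure d).real σ * J σ := by
  have hb : Bornology.IsBounded Ω := Metric.isBounded_ball.subset hΩ
  have : Nonempty (Fin d) := ⟨⟨0, hd⟩⟩
  obtain ⟨h, hh⟩ := exists_norm_eq (EuclideanSpace ℝ (Fin d)) (c := 2 * R) (by positivity)
  have hsum : 0 ≤ ∑ σ ∈ D.edges, (surfaceMeasure d).real σ * J σ :=
    Finset.sum_nonneg fun σ hσ => mul_nonneg measureReal_nonneg (hJ.nonneg hσ)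
  rw [← ENNReal.ofReal_le_ofReal_iff (by positivity), ← D.lintegral_enorm_stepFun hb w, ← hh]
  refine (lintegral_mono fun x => ?_).trans (hJ.lintegral_stepFun_translate_le hb h)
  rw [← Real.enorm_eq_ofReal_abs]
  by_cases hx : x ∈ Ω
  · have hxh : x + h ∉ Ω := by
      intro hmem
      have h1 := mem_ball_zero_iff.1 (hΩ hx)
      have h2 := mem_ball_zero_iff.1 (hΩ hmem)
      have h3 := norm_sub_le (x + h) x
      rw [add_sub_cancel_left, hh] at h3
      linarith
    rw [stepFun_of_notMem_domain w hxh, zero_sub, enorm_neg]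
  · rw [stepFun_of_notMem_domain w hx, enorm_zero]
    exact zero_le

/-- Uniform bounds, in `L¹` and in total variation, on the signed `p`-th powers of piecewise
constant functions whose discrete `W^{1,p}` norms are bounded. -/
theorem exists_uniform_bounds (hd : 1 ≤ d) (hb : Bornology.IsBounded Ω) {p η : ℝ} (hp : 1 ≤ p)
    (hη : 0 < η) (C : ℝ) :
    ∃ I V : ℝ, 0 ≤ V ∧ ∀ D : SpaceDiscretisation Ω, D.RatioBound η →
      ∀ u : EuclideanSpace ℝ (Fin d) → ℝ, D.discreteNorm p u ≤ C →
        ∑ K ∈ D.cells, volume.real K * |D.cellValue u K| ^ p ≤ I ∧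
        ∑ σ ∈ D.edges, (surfaceMeasure d).real σ * D.powJump p u σ ≤ V := by
  obtain ⟨R, hR, hΩ⟩ := hb.subset_ball_lt 0 0
  set c := p * (1 + 1 / η) with hc
  have hc0 : 0 < c := by positivity
  -- Chosen so that `2 * R * c * ε * 2 ^ d = 1 / 2`. The Poincaré inequality then reads `N ≤ N / 2 +
  -- I / 2`.
  set ε := (4 * R * c * 2 ^ d)⁻¹ with hε
  have hε0 : 0 < ε := by positivity
  set I := 4 * R * c * ε ^ (1 - p) * |C| ^ p with hI
  refine ⟨I, c * (ε * (2 ^ d * I) + ε ^ (1 - p) * |C| ^ p), by positivity, fun D hD u hu => ?_⟩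
  set N := ∑ K ∈ D.cells, volume.real K * |D.cellValue u K| ^ p with hN
  have h1 := sum_powJump_le hd hb hp hη hε0 hD hu
  have h2 := (D.boundsJumps_signedPow hp u).sum_volume_mul_abs_le hd hR.le hΩ
  simp_rw [abs_signedPow hp] at h2
  rw [← hN, ← hc] at h1
  rw [← hN] at h2
  have h3 : 2 * R * (c * (ε * (2 ^ d * N))) = N / 2 := by
    rw [hε]
    field_simp
    norm_num
  have hNI : N ≤ I := by
    have h4 : N ≤ 2 * R * (c * (ε * (2 ^ d * N) + ε ^ (1 - p) * |C| ^ p)) :=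
      h2.trans (by gcongr)
    have h5 : 2 * R * (c * (ε * (2 ^ d * N) + ε ^ (1 - p) * |C| ^ p)) = N / 2 + I / 2 := by
      rw [mul_add, mul_add, h3, hI]
      ring
    linarith
  exact ⟨hNI, h1.trans (by gcongr)⟩

end SpaceDiscretisation

/-! ### Relative compactness in `L^p` -/

theorem lemma5p6 {d : ℕ} (hd : 1 ≤ d) (p : ℝ≥0∞) [Fact (1 ≤ p)] (hp : p ≠ ∞)
    (Ω : Set (EuclideanSpace ℝ (Fin d))) (hopen : IsOpen Ω) (hbdd : Bornology.IsBounded Ω)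
    (hconn : IsConnected Ω) (hpoly : IsPolyhedral Ω)
    {ι : Type*} (D : ι → SpaceDiscretisation Ω)
    (η : ℝ) (hη : 0 < η) (hratio : ∀ i, (D i).RatioBound η)
    (u : ι → EuclideanSpace ℝ (Fin d) → ℝ) (hu : ∀ i, (D i).PiecewiseConstant (u i))
    (C : ℝ) (hC : ∀ i, (D i).discreteNorm p.toReal (u i) ≤ C) :
    (∃ h : ∀ i, MemLp (u i) p (volume.restrict Ω),
      IsCompact (closure (Set.range fun i => (h i).toLp (u i)))) ∧
    (∃ h : ∀ i, MemLp (Ω.indicator (u i)) p volume,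
      IsCompact (closure (Set.range fun i => (h i).toLp (Ω.indicator (u i))))) := by
  have hp1 : 1 ≤ p := Fact.out
  have hp0 : p ≠ 0 := (zero_lt_one.trans_le hp1).ne'
  have hr : 1 ≤ p.toReal := by
    rw [← ENNReal.toReal_one]
    exact ENNReal.toReal_mono hp hp1
  have hr0 : 0 < p.toReal := by linarith
  have hΩm := hopen.measurableSet
  have hmem : ∀ i, MemLp (Ω.indicator (u i)) p volume := fun i =>
    ((D i).memLp_stepFun hbdd _ p).ae_eq (hu i).indicator_ae_eq.symm
  have hmem' : ∀ i, MemLp (u i) p (volume.restrict Ω) := fun i =>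
    (memLp_indicator_iff_restrict hΩm).1 (hmem i)
  obtain ⟨I, V, hV0, hIV⟩ := SpaceDiscretisation.exists_uniform_bounds hd hbdd hr hη C
  let w : ι → EuclideanSpace ℝ (Fin d) → ℝ := fun i =>
    (D i).stepFun fun K => signedPow p.toReal ((D i).cellValue (u i) K)
  have hwI : ∀ i, ∫⁻ x, ‖w i x‖ₑ ≤ ENNReal.ofReal I := fun i => by
    rw [(D i).lintegral_enorm_stepFun hbdd]
    simp_rw [abs_signedPow hr]
    exact ENNReal.ofReal_le_ofReal (hIV (D i) (hratio i) (u i) (hC i)).1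
  have hwV : ∀ i h, ∫⁻ x, ‖w i (x + h) - w i x‖ₑ ≤ ENNReal.ofReal (‖h‖ * V) := fun i h => by
    simp_rw [Real.enorm_eq_ofReal_abs]
    refine (((D i).boundsJumps_signedPow hr (u i)).lintegral_stepFun_translate_le hbdd h).trans ?_
    have := (hIV (D i) (hratio i) (u i) (hC i)).2
    gcongr
  have hw : ∀ i, ∀ᵐ x ∂volume.restrict Ω, w i x = signedPow p.toReal (u i x) := fun i => by
    rw [ae_restrict_iff' hΩm]
    filter_upwards [(hu i).indicator_ae_eq] with x hx hxΩ
    rw [Set.indicator_of_mem hxΩ] at hx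
    simp only [w]
    rw [SpaceDiscretisation.stepFun_comp (signedPow_zero _), hx]
  have hnet : ∀ δ : ℝ, 0 < δ → ∃ t : Set ι, t.Finite ∧
      ∀ i, ∃ j ∈ t, eLpNorm (u i - u j) p (volume.restrict Ω) ≤ ENNReal.ofReal δ := by
    intro δ hδ
    -- The tolerance `(δ / 2) ^ p` offsets the factor `2 ^ p` of `abs_sub_rpow_le_signedPow`.
    obtain ⟨t, ht, hcov⟩ := exists_finite_net_of_translate_le
      (fun i => (D i).measurable_stepFun _) hwI hV0 hwV hbdd
      (ε := (δ / 2) ^ p.toReal) (by positivity)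
    refine ⟨t, ht, fun i => ?_⟩
    obtain ⟨j, hj, hij⟩ := hcov i
    refine ⟨j, hj, ?_⟩
    rw [eLpNorm_eq_lintegral_rpow_enorm_toReal hp0 hp, one_div,
      ENNReal.rpow_inv_le_iff hr0]
    calc ∫⁻ x in Ω, ‖(u i - u j) x‖ₑ ^ p.toReal
        ≤ ∫⁻ x in Ω, ENNReal.ofReal (2 ^ p.toReal) * ‖w i x - w j x‖ₑ := by
          refine lintegral_mono_ae ?_
          filter_upwards [hw i, hw j] with x hi hj
          rw [hi, hj, Real.enorm_eq_ofReal_abs, Real.enorm_eq_ofReal_abs,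
            ← ENNReal.ofReal_mul (by positivity), ENNReal.ofReal_rpow_of_nonneg (abs_nonneg _) hr0.le]
          exact ENNReal.ofReal_le_ofReal (abs_sub_rpow_le_signedPow hr _ _)
      _ = ENNReal.ofReal (2 ^ p.toReal) * ∫⁻ x in Ω, ‖w i x - w j x‖ₑ :=
          lintegral_const_mul' _ _ ENNReal.ofReal_ne_top
      _ ≤ ENNReal.ofReal (2 ^ p.toReal) * ENNReal.ofReal ((δ / 2) ^ p.toReal) := by gcongr
      _ = ENNReal.ofReal δ ^ p.toReal := by
          rw [← ENNReal.ofReal_mul (by positivity), ← Real.mul_rpow zero_le_two (by positivity),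
            mul_div_cancel₀ _ two_ne_zero, ENNReal.ofReal_rpow_of_nonneg hδ.le hr0.le]
  refine ⟨⟨hmem', isCompact_closure_range_toLp hmem' hnet⟩,
    ⟨hmem, isCompact_closure_range_toLp hmem fun δ hδ => ?_⟩⟩
  obtain ⟨t, ht, hcov⟩ := hnet δ hδ
  refine ⟨t, ht, fun i => ?_⟩
  obtain ⟨j, hj, hij⟩ := hcov i
  refine ⟨j, hj, ?_⟩
  rwa [← Set.indicator_sub', eLpNorm_indicator_eq_eLpNorm_restrict hΩm]
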